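/- **Setting.** Fix a first-order signature, a theory $CT$ over it whose equality satisfies the Clark Equality Theory (function symbols are injective, distinct function symbols have disjoint ranges, occurs check), and a set of predicate symbols for *CHR constraints* $p(t_1,\dots,t_m)$. *Built-in constraints* are $c::=d\mid c\wedge c\mid\exists_x c$ with $d$ atomic (an equation, a relation, $\mathtt{true}$ or $\mathtt{false}$). $H=H'$ denotes the set of equations between the arguments of two sequences of CHR constraints; it is defined only if the lengths, predicates and arities agree. $Fv$ denotes free variables. An *identified* constraint $h\#i$ is a CHR constraint with a positive integer $i$; $chr(h\#i)=h$ and $id(h\#i)=i$. A *token* $r@i_1,\dots,i_l$ is a name with a sequence of identifiers. *Annotated programs.* An annotated rule is $r@H_1\backslash H_2\Leftrightarrow D\mid\tilde B;T$, with a name $r$ (names need not be unique), sequences $H_1,H_2$ of CHR constraints, not both empty, a multiset $D$ of built-in constraints (guard), a body $\tilde B$ of built-in and identified CHR constraints with pairwise different identifiers, and a set $T$ of tokens whose identifiers occur in $\tilde B$. An annotated program is a finite set of such rules. $inst(\tilde B,T,n)=(\tilde B',T',m)$, where $(\tilde B',T')$ is $(\tilde B,T)$ with all identifiers incremented by $n$,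 and $m$ is the greatest identifier in $(\tilde B',T')$ ($m=n$ if there is none). $clean(\tilde B,T)$ is the set of those tokens of $T$ all of whose identifiers occur in $\tilde B$. *Semantics.* A configuration is $\langle\tilde S,C,T\rangle_n$, where $\tilde S$ consists of built-in constraints and of CHR constraints with distinct identifiers, $C$ is a built-in constraint (the store), $T$ is a set of tokens, and the identifiers in $\tilde S$ and $T$ are at most $n$. It is *failed* if $CT\models C\leftrightarrow\mathtt{false}$. The steps are: - Solve': $\langle\{c\}\cup\tilde G,C,T\rangle_n\to\langle\tilde G,C',T\rangle_n$ if $c,C'$ are built-in constraints and $CT\models c\wedge C\leftrightarrow C'$. - Apply': $\langle\tilde H_1\cup\tilde H_2\cup\tilde G,C,T\rangle_n\to\langle\tilde B'\cup\tilde H_1\cup\tilde G,\;(chr(\tilde H_1,\tilde H_2)=(H_1',H_2'))\wedge C,\;T'\rangle_m$ if $r@H_1'\backslash H_2'\Leftrightarrow D\mid\tilde B;T_r$ is a rule of $P$ with its variables renamed apart from the computation (that is, from the current configuration and from the initial one), $CT\models C\to\exists_x\big((chr(\tilde H_1,\tilde H_2)=(H_1',H_2'))\wedge D\big)$ with $x=Fv(H_1',H_2')$,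 $r@id(\tilde H_1,\tilde H_2)\notin T$, and $(\tilde B',T_r',m)=inst(\tilde B,T_r,n)$; here $T'=T\cup T_r'\cup\{r@id(\tilde H_1,\tilde H_2)\}$ if $\tilde H_2=\emptyset$, and $T'=T\cup T_r'$ otherwise. A derivation is *normal* if Apply' is used only on configurations that are failed or have no built-in constraint in $\tilde S$. A goal $G$ is a multiset of CHR and built-in constraints; if it has $m$ CHR constraints, its initial configuration is $\sigma_G=\langle\tilde G,\mathtt{true},\emptyset\rangle_m$, where $\tilde G$ is $G$ with its CHR constraints numbered $1,\dots,m$. The set of *qualified answers* is $$\mathcal{QA}'_P(G)=\{\exists_{-Fv(G)}(chr(\tilde K)\wedge d)\mid\sigma_G\to^*\langle\tilde K,d,T\rangle_n\not\to\}\cup\{\mathtt{false}\mid\sigma_G\to^*\langle\tilde G',d,T\rangle_n\text{ failed}\},$$ where $\exists_{-V}$ quantifies all variables except those in $V$. Answers are taken up to renaming of variables not in $Fv(G)$ and $CT$-equivalence of their built-in part, and an answer with inconsistent built-in part is identified with $\mathtt{false}$. *Termination and confluence.* $P$ is *normal terminating* if no goal has an infinite normal computation (failed configurations are final). For a set $V$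 of variables, $\sigma\simeq'_V\tau$ means that $\sigma$ and $\tau$ are both failed, or that they are identical up to renaming of variables not in $V$, renaming of identifiers, deletion of the tokens having an identifier that does not occur in the configuration, and $CT$-equivalence of built-in constraints. $P$ is *normal confluent* if for all normal derivations $\sigma\to^*\sigma_1$ and $\sigma\to^*\sigma_2$ there are derivations $\sigma_1\to^*\tau_1$ and $\sigma_2\to^*\tau_2$ with $\tau_1\simeq'_{Fv(\sigma)}\tau_2$. *Unfolding.* Let $r@H_1\backslash H_2\Leftrightarrow D\mid\tilde K,\tilde S_1,\tilde S_2,C;T$ be a rule of $P$, where $C$ is the conjunction of all built-in constraints of its body, and let $v@H_1'\backslash H_2'\Leftrightarrow D'\mid\tilde B;T'$ be a rule of $P$ renamed apart from it. Let $\theta$ be a substitution acting only on $Fv(H_1',H_2')$ with $CT\models(C\wedge D)\to chr(\tilde S_1,\tilde S_2)=(H_1',H_2')\theta$, let $v@id(\tilde S_1,\tilde S_2)\notin T$, let $D''$ consist of the constraints $c$ of $D'$ with $CT\not\models(C\wedge D)\to c\theta$, and suppose that $D,D''\theta$ is satisfiable with respect to $CT$. Let $(\tilde B_1,T_1,m_1)=inst(\tilde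 B,T',m)$, where $m$ is the greatest identifier in the rule $r$. The unfolded rule is $$r@H_1\backslash H_2\Leftrightarrow D,D''\theta\mid\tilde K,\tilde S_1,\tilde B_1,C,\,chr(\tilde S_1,\tilde S_2)=(H_1',H_2');\,T'',$$ where $T''=clean((\tilde K,\tilde S_1),T)\cup T_1$, with the token $v@id(\tilde S_1)$ added if $H_2'=\emptyset$. $Unf_P(r)$ is the set of all rules obtained in this way from the rule $r$ and the rules $v$ of $P$. The rule $r$, with guard $D$, *can be weakly safely replaced* in $P$ if some rule in $Unf_P(r)$ has a guard $E$ with $CT\models D\leftrightarrow E$. **Theorem.** Let $P$ be a normal terminating and normal confluent annotated program, let $r\in P$ be a rule that can be weakly safely replaced in $P$, and let $P'=(P\setminus\{r\})\cup Unf_P(r)$. Then $\mathcal{QA}'_P(G)=\mathcal{QA}'_{P'}(G)$ for every goal $G$. -/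

import Mathlib

open FirstOrder

universe u v w w'

namespace CHR

/-! ### Built-in constraints and the constraint theory -/

/-- Built-in constraints over the signature `L`, with variables named by natural numbers:
`c ::= d | c ∧ c | ∃ x, c` with `d` atomic (an equation or a relation between terms).  The
constants `true` (the empty conjunction) and `false` are included. -/
inductive IsBuiltin {L : FirstOrder.Language.{u, v}} : ∀ {n : ℕ}, L.BoundedFormula ℕ n → Prop
  | tru {n : ℕ} : IsBuiltin (⊤ : L.BoundedFormula ℕ n)
  | fls {n : ℕ} : IsBuiltin (⊥ : L.BoundedFormula ℕ n)
  | eq {n : ℕ} (s t : L.Term (ℕ ⊕ Fin n)) : IsBuiltin (s.bdEqual t)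
  | rel {n l : ℕ} (R : L.Relations l) (ts : Fin l → L.Term (ℕ ⊕ Fin n)) :
      IsBuiltin (R.boundedFormula ts)
  | and {n : ℕ} {φ ψ : L.BoundedFormula ℕ n} (hφ : IsBuiltin φ) (hψ : IsBuiltin ψ) :
      IsBuiltin (φ ⊓ ψ)
  | ex {n : ℕ} {φ : L.BoundedFormula ℕ (n + 1)} (hφ : IsBuiltin φ) : IsBuiltin φ.ex

/-- Models of the constraint theory. -/
abbrev Model {L : FirstOrder.Language.{u, v}} (CT : L.Theory) := FirstOrder.Language.Theory.ModelType.{u, v, max u v} CT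

/-- In the theory `CT`, equality satisfies the Clark Equality Theory: function symbols are
injective, distinct function symbols have disjoint ranges, and a variable differs from every
other term in which it occurs (occurs check). -/
structure ClarkEquality {L : FirstOrder.Language.{u, v}} (CT : L.Theory) : Prop where
  injective : ∀ (M : Model CT) {n : ℕ} (f : L.Functions n),
    Function.Injective (fun xs : Fin n → M => FirstOrder.Language.Structure.funMap f xs)
  disjoint : ∀ (M : Model CT) {n m : ℕ} (f : L.Functions n) (g : L.Functions m),
    (⟨n, f⟩ : Σ k, L.Functions k) ≠ ⟨m, g⟩ → ∀ (xs : Fin n → M) (ys : Fin m → M),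
      FirstOrder.Language.Structure.funMap f xs ≠ FirstOrder.Language.Structure.funMap g ys
  occurs : ∀ (M : Model CT) (t : L.Term ℕ) (x : ℕ), x ∈ t.varFinset → t ≠ FirstOrder.Language.Term.var x →
    ∀ val : ℕ → M, t.realize val ≠ val x

section

variable {L : FirstOrder.Language.{u, v}} {Pr : Type w} {N : Type w'}

/-- All formulas of the multiset (read as a conjunction) hold under the valuation. -/
def Holds {M : Type*} [L.Structure M] (Γ : Multiset (L.Formula ℕ)) (val : ℕ → M) : Prop :=
  ∀ c ∈ Γ, c.Realize val

/-- `CT ⊨ c ↔ false`. -/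
def Inconsistent (CT : L.Theory) (c : L.Formula ℕ) : Prop := CT.Iff c ⊥

/-- Satisfiability of a conjunction of constraints with respect to `CT`. -/
def Satisfiable (CT : L.Theory) (Γ : Multiset (L.Formula ℕ)) : Prop :=
  ∃ (M : Model CT) (val : ℕ → M), Holds Γ val

/-- `CT ⊨ Γ → c`. -/
def Entails (CT : L.Theory) (Γ : Multiset (L.Formula ℕ)) (c : L.Formula ℕ) : Prop :=
  ∀ (M : Model CT) (val : ℕ → M), Holds Γ val → c.Realize val

/-- `CT ⊨ Γ ↔ Δ`. -/
def Equivalent (CT : L.Theory) (Γ Δ : Multiset (L.Formula ℕ)) : Prop :=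
  ∀ (M : Model CT) (val : ℕ → M), Holds Γ val ↔ Holds Δ val

/-- `CT ⊨ c → ∃ x, Γ`, where `x` is a set of variables. -/
def EntailsExists (CT : L.Theory) (c : L.Formula ℕ) (x : Set ℕ)
    (Γ : Multiset (L.Formula ℕ)) : Prop :=
  ∀ (M : Model CT) (val : ℕ → M), c.Realize val →
    ∃ val' : ℕ → M, (∀ y, y ∉ x → val' y = val y) ∧ Holds Γ val'

/-- Application of a substitution to a formula (bound variables are never captured). -/
def substF (θ : ℕ → L.Term ℕ) (c : L.Formula ℕ) : L.Formula ℕ :=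
  FirstOrder.Language.BoundedFormula.subst c θ

/-- A renaming of variables seen as a substitution. -/
def renSubst (ρ : Equiv.Perm ℕ) : ℕ → L.Term ℕ := fun x => FirstOrder.Language.Term.var (ρ x)

/-- The free variables of a multiset of formulas. -/
def fvF (Γ : Multiset (L.Formula ℕ)) : Set ℕ :=
  {x | ∃ c ∈ Γ, x ∈ FirstOrder.Language.BoundedFormula.freeVarFinset c}

/-! ### User-defined constraints -/

variable (L Pr) in
/-- A CHR (user-defined) constraint `p(t₁, …, tₘ)`. -/
structure Atom where
  pred : Pr
  args : List (L.Term ℕ)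

/-- Application of a substitution to a CHR constraint. -/
def Atom.subst (θ : ℕ → L.Term ℕ) (a : Atom L Pr) : Atom L Pr :=
  ⟨a.pred, a.args.map fun t => t.subst θ⟩

/-- The variables of a CHR constraint. -/
def Atom.fv (a : Atom L Pr) : Set ℕ := {x | ∃ t ∈ a.args, x ∈ t.varFinset}

/-- The variables of a sequence of CHR constraints. -/
def fvA (H : List (Atom L Pr)) : Set ℕ := {x | ∃ a ∈ H, x ∈ a.fv}

/-- `H = H'` is defined: the sequences have the same length and corresponding constraints have
the same predicate and the same number of arguments. -/
def Comparable (H H' : List (Atom L Pr)) : Prop :=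
  List.Forall₂ (fun a b => a.pred = b.pred ∧ a.args.length = b.args.length) H H'

/-- The equations `H = H'` between the arguments of two sequences of CHR constraints. -/
def eqs (H H' : List (Atom L Pr)) : List (L.Formula ℕ) :=
  (List.zipWith
    (fun a b => List.zipWith (fun s t => FirstOrder.Language.Term.equal s t) a.args b.args) H H').flatten

/-- The conjunction of a list of formulas. -/
def conj (l : List (L.Formula ℕ)) : L.Formula ℕ := l.foldr (fun c d => c ⊓ d) ⊤

variable (L Pr) in
/-- An identified CHR constraint `h#i`. -/
abbrev IdAtom := Atom L Pr × ℕ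

variable (N) in
/-- A token `r@i₁, …, iₗ`. -/
abbrev Token := N × List ℕ

/-- The function `chr`, removing identifiers. -/
def chr (H : List (IdAtom L Pr)) : List (Atom L Pr) := H.map Prod.fst

/-- The sequence of identifiers of a sequence of identified constraints. -/
def ids (H : List (IdAtom L Pr)) : List ℕ := H.map Prod.snd

/-- The variables of a multiset of identified constraints. -/
def fvI (B : Multiset (IdAtom L Pr)) : Set ℕ := {x | ∃ a ∈ B, x ∈ a.1.fv}

/-- The set of identifiers occurring in a multiset of identified constraints. -/
def idSet (B : Multiset (IdAtom L Pr)) : Set ℕ := {i | ∃ a ∈ B, a.2 = i}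

/-- The set of identifiers occurring in a token store. -/
def tokenIds (T : Set (Token N)) : Set ℕ := {i | ∃ t ∈ T, i ∈ t.2}

/-- The greatest identifier occurring in `(B, T)`, and `0` if there is none. -/
noncomputable def maxId (B : Multiset (IdAtom L Pr)) (T : Set (Token N)) : ℕ :=
  sSup (idSet B ∪ tokenIds T)

/-- Increments every identifier by `n`. -/
def shiftI (n : ℕ) (B : Multiset (IdAtom L Pr)) : Multiset (IdAtom L Pr) :=
  B.map fun a => (a.1, a.2 + n)

/-- Increments every identifier of a token store by `n`. -/
def shiftT (n : ℕ) (T : Set (Token N)) : Set (Token N) :=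
  (fun t => (t.1, t.2.map fun i => i + n)) '' T

/-- The function `inst`.  The last component is the greatest identifier in the incremented pair,
and `n` if there are no identifiers at all. -/
noncomputable def inst (B : Multiset (IdAtom L Pr)) (T : Set (Token N)) (n : ℕ) :
    Multiset (IdAtom L Pr) × Set (Token N) × ℕ :=
  (shiftI n B, shiftT n T, n + maxId B T)

/-- `clean B T` deletes from `T` the tokens with an identifier not present in `B`. -/
def clean (B : Multiset (IdAtom L Pr)) (T : Set (Token N)) : Set (Token N) :=
  {t | t ∈ T ∧ ∀ i ∈ t.2, i ∈ idSet B}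

/-! ### Annotated programs -/

variable (L Pr N) in
/-- An annotated rule `name @ keep \ remove ⇔ guard | chr, bi ; tokens`; the body is split into
its identified CHR constraints and its built-in constraints. -/
structure Rule where
  name : N
  keep : List (Atom L Pr)
  remove : List (Atom L Pr)
  guard : Multiset (L.Formula ℕ)
  chr : Multiset (IdAtom L Pr)
  bi : Multiset (L.Formula ℕ)
  tokens : Set (Token N)

namespace Rule

/-- The whole head of a rule. -/
def head (r : Rule L Pr N) : List (Atom L Pr) := r.keep ++ r.remove

/-- The free variables of a rule. -/
def fv (r : Rule L Pr N) : Set ℕ := fvA r.head ∪ fvF r.guard ∪ fvI r.chr ∪ fvF r.bi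

/-- Renaming of the variables of a rule. -/
def rename (ρ : Equiv.Perm ℕ) (r : Rule L Pr N) : Rule L Pr N where
  name := r.name
  keep := r.keep.map (Atom.subst (renSubst ρ))
  remove := r.remove.map (Atom.subst (renSubst ρ))
  guard := r.guard.map (substF (renSubst ρ))
  chr := r.chr.map fun a => (a.1.subst (renSubst ρ), a.2)
  bi := r.bi.map (substF (renSubst ρ))
  tokens := r.tokens

/-- Well-formed annotated rules: the head is not empty, guard and body contain built-in
constraints, the identifiers in the body are positive and pairwise different, and the local token
store only mentions identifiers of the body. -/
structure WF (r : Rule L Pr N) : Prop where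
  head_ne : r.head ≠ []
  guard_builtin : ∀ c ∈ r.guard, IsBuiltin c
  bi_builtin : ∀ c ∈ r.bi, IsBuiltin c
  nodup : (r.chr.map Prod.snd).Nodup
  pos : ∀ i ∈ idSet r.chr, 0 < i
  tokens_sub : tokenIds r.tokens ⊆ idSet r.chr

end Rule

/-- An annotated CHR program is a finite set of annotated rules. -/
def IsProgram (P : Set (Rule L Pr N)) : Prop := P.Finite ∧ ∀ r ∈ P, r.WF

/-! ### Operational semantics of annotated programs -/

variable (L Pr N) in
/-- A configuration `⟨S, C, T⟩ₙ`; the store `S` is split into its identified CHR constraints and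
its (not yet solved) built-in constraints. -/
structure State where
  chr : Multiset (IdAtom L Pr)
  bi : Multiset (L.Formula ℕ)
  store : L.Formula ℕ
  tokens : Set (Token N)
  cnt : ℕ

namespace State

/-- The free variables of a configuration. -/
def fv (σ : State L Pr N) : Set ℕ := fvI σ.chr ∪ fvF σ.bi ∪ fvF {σ.store}

/-- Well-formed configurations: the stores contain built-in constraints, the identified CHR
constraints carry pairwise different positive identifiers, and the counter bounds every
identifier used so far. -/
structure WF (σ : State L Pr N) : Prop where
  bi_builtin : ∀ c ∈ σ.bi, IsBuiltin c
  store_builtin : IsBuiltin σ.store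
  nodup : (σ.chr.map Prod.snd).Nodup
  pos : ∀ i ∈ idSet σ.chr, 0 < i
  chr_le : ∀ i ∈ idSet σ.chr, i ≤ σ.cnt
  tokens_le : ∀ i ∈ tokenIds σ.tokens, i ≤ σ.cnt

/-- Failed configurations: the built-in store is inconsistent. -/
def Failed (CT : L.Theory) (σ : State L Pr N) : Prop := Inconsistent CT σ.store

/-- Built-in free configurations. -/
def BuiltinFree (CT : L.Theory) (σ : State L Pr N) : Prop := σ.Failed CT ∨ σ.bi = 0

end State

/-- The transition Solve', moving a built-in constraint to the built-in store. -/
inductive Solve (CT : L.Theory) : State L Pr N → State L Pr N → Prop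
  | intro (K : Multiset (IdAtom L Pr)) (B : Multiset (L.Formula ℕ)) (c C C' : L.Formula ℕ)
      (T : Set (Token N)) (n : ℕ) (hC' : IsBuiltin C') (h : CT.Iff (c ⊓ C) C') :
      Solve CT ⟨K, c ::ₘ B, C, T, n⟩ ⟨K, B, C', T, n⟩

open Classical in
/-- The transition Apply' with a rule of `P`, renamed apart from the current configuration and
from the set `V` of the variables of interest of the computation (those of its initial
configuration).  `H₁` and `H₂` are the sequences of constraints matched with the two parts of the
head, and `x = Fv(H₁', H₂')`. -/
inductive Apply (CT : L.Theory) (P : Set (Rule L Pr N)) (V : Set ℕ) :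
    State L Pr N → State L Pr N → Prop
  | intro (r₀ : Rule L Pr N) (hr₀ : r₀ ∈ P) (ρ : Equiv.Perm ℕ)
      (r : Rule L Pr N) (hr : r = r₀.rename ρ)
      (H₁ H₂ : List (IdAtom L Pr)) (K : Multiset (IdAtom L Pr)) (B : Multiset (L.Formula ℕ))
      (C : L.Formula ℕ) (T : Set (Token N)) (n : ℕ)
      (hfresh : Disjoint r.fv
        (V ∪ State.fv (⟨↑H₁ + ↑H₂ + K, B, C, T, n⟩ : State L Pr N)))
      (hkeep : Comparable (chr H₁) r.keep) (hremove : Comparable (chr H₂) r.remove)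
      (hent : EntailsExists CT C (fvA r.head) (↑(eqs (chr (H₁ ++ H₂)) r.head) + r.guard))
      (htoken : (r.name, ids (H₁ ++ H₂)) ∉ T)
      (B' : Multiset (IdAtom L Pr)) (T' : Set (Token N)) (m : ℕ)
      (hinst : (B', T', m) = inst r.chr r.tokens n) :
      Apply CT P V ⟨↑H₁ + ↑H₂ + K, B, C, T, n⟩
        ⟨B' + ↑H₁ + K, r.bi + B, conj (eqs (chr (H₁ ++ H₂)) r.head) ⊓ C,
          if H₂ = [] then T ∪ {(r.name, ids (H₁ ++ H₂))} ∪ T' else T ∪ T', m⟩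

/-- One computation step. -/
def Step (CT : L.Theory) (P : Set (Rule L Pr N)) (V : Set ℕ) (σ τ : State L Pr N) : Prop :=
  Solve CT σ τ ∨ Apply CT P V σ τ

/-- One step of a normal derivation: Apply' is only used on built-in free configurations. -/
def NormalStep (CT : L.Theory) (P : Set (Rule L Pr N)) (V : Set ℕ) (σ τ : State L Pr N) : Prop :=
  Solve CT σ τ ∨ (σ.BuiltinFree CT ∧ Apply CT P V σ τ)

/-- Derivations. -/
def Derives (CT : L.Theory) (P : Set (Rule L Pr N)) (V : Set ℕ) :
    State L Pr N → State L Pr N → Prop :=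
  Relation.ReflTransGen (Step CT P V)

/-- Normal derivations. -/
def NormalDerives (CT : L.Theory) (P : Set (Rule L Pr N)) (V : Set ℕ) :
    State L Pr N → State L Pr N → Prop :=
  Relation.ReflTransGen (NormalStep CT P V)

/-! ### Goals and qualified answers -/

variable (L Pr) in
/-- A goal: a multiset of CHR and built-in constraints.  The CHR constraints are listed in the
order in which they receive their identifiers. -/
structure Goal where
  atoms : List (Atom L Pr)
  bi : Multiset (L.Formula ℕ)

namespace Goal

/-- The built-in part of the goal consists of built-in constraints. -/
def WF (G : Goal L Pr) : Prop := ∀ c ∈ G.bi, IsBuiltin c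

/-- The free variables of a goal. -/
def fv (G : Goal L Pr) : Set ℕ := fvA G.atoms ∪ fvF G.bi

variable (N) in
/-- The initial configuration `⟨I₀ᵐ(G), true, ∅⟩ₘ`, where `m` is the number of CHR constraints. -/
def init (G : Goal L Pr) : State L Pr N :=
  ⟨↑(G.atoms.zipIdx 1), G.bi, ⊤, ∅, G.atoms.length⟩

end Goal

variable (L Pr) in
/-- The pair `(K, d)` stands for the answer `∃_{-V} (K ∧ d)`, where `V` is the set of variables of
the goal. -/
abbrev Answer := Multiset (Atom L Pr) × L.Formula ℕ

/-- Two answers denote the same formula `∃_{-V} (K ∧ d)`, up to renaming of the quantified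
variables and logical equivalence of built-in constraints; all answers with an inconsistent
built-in part are identified with `false`. -/
def SameAnswer (CT : L.Theory) (V : Set ℕ) (a b : Answer L Pr) : Prop :=
  (Inconsistent CT a.2 ∧ Inconsistent CT b.2) ∨
  ∃ ρ : Equiv.Perm ℕ, (∀ x ∈ V, ρ x = x) ∧
    a.1.map (Atom.subst (renSubst ρ)) = b.1 ∧ CT.Iff (substF (renSubst ρ) a.2) b.2

/-- The qualified answers of the goal `G` in the annotated program `P`.  They are formulas up to
`SameAnswer`, so the set contains every pair that denotes one of them. -/
def QA' (CT : L.Theory) (P : Set (Rule L Pr N)) (G : Goal L Pr) : Set (Answer L Pr) :=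
  {a | ∃ σ, Derives CT P G.fv (G.init N) σ ∧ (∀ τ, ¬ Step CT P G.fv σ τ) ∧
    SameAnswer CT G.fv a (σ.chr.map Prod.fst, σ.store)} ∪
  {a | ∃ σ, Derives CT P G.fv (G.init N) σ ∧ σ.Failed CT ∧ SameAnswer CT G.fv a (0, ⊥)}

/-! ### Normal termination and normal confluence -/

/-- Normal termination: no goal has an infinite normal computation.  Failed configurations are
final, so a computation stops when it reaches one. -/
def NormalTerminating (CT : L.Theory) (P : Set (Rule L Pr N)) : Prop :=
  ∀ G : Goal L Pr, G.WF → ¬ ∃ s : ℕ → State L Pr N, s 0 = G.init N ∧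
    ∀ i, ¬ (s i).Failed CT ∧ NormalStep CT P G.fv (s i) (s (i + 1))

/-- Configurations that are both failed, or identical up to renaming of the variables not in `V`
and of the identifiers, cleaning of the token store, and logical equivalence of built-in
constraints. -/
def StateEquiv (CT : L.Theory) (V : Set ℕ) (σ τ : State L Pr N) : Prop :=
  (σ.Failed CT ∧ τ.Failed CT) ∨
  ∃ (ρ : Equiv.Perm ℕ) (π : Equiv.Perm ℕ), (∀ x ∈ V, ρ x = x) ∧
    σ.chr.map (fun a => (a.1.subst (renSubst ρ), π a.2)) = τ.chr ∧
    Multiset.Rel CT.Iff (σ.bi.map (substF (renSubst ρ))) τ.bi ∧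
    CT.Iff (substF (renSubst ρ) σ.store) τ.store ∧
    (fun t : Token N => (t.1, t.2.map π)) '' clean σ.chr σ.tokens = clean τ.chr τ.tokens

/-- Normal confluence. -/
def NormalConfluent (CT : L.Theory) (P : Set (Rule L Pr N)) : Prop :=
  ∀ σ σ₁ σ₂ : State L Pr N, σ.WF →
    NormalDerives CT P σ.fv σ σ₁ → NormalDerives CT P σ.fv σ σ₂ →
    ∃ τ₁ τ₂, Derives CT P σ.fv σ₁ τ₁ ∧ Derives CT P σ.fv σ₂ τ₂ ∧ StateEquiv CT σ.fv τ₁ τ₂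

/-! ### Unfolding -/

open Classical in
/-- `IsUnfolding CT r v r'`: the rule `r'` is obtained by unfolding `r` with `v`, which is already
renamed apart from `r`.  The CHR constraints of the body of `r` are split as `K, S₁, S₂`, where
`S₁, S₂` match the head of `v` by the substitution `θ` of the variables of that head.  The guard
constraints `c` of `v` for which `cθ` is entailed by the built-in constraints of `r` are dropped. -/
def IsUnfolding (CT : L.Theory) (r v r' : Rule L Pr N) : Prop :=
  ∃ (K : Multiset (IdAtom L Pr)) (S₁ S₂ : List (IdAtom L Pr)) (θ : ℕ → L.Term ℕ)
    (D'' : Multiset (L.Formula ℕ)) (B₁ : Multiset (IdAtom L Pr)) (T₁ : Set (Token N)) (m₁ : ℕ),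
    r.chr = K + ↑S₁ + ↑S₂ ∧
    Comparable (chr S₁) v.keep ∧ Comparable (chr S₂) v.remove ∧
    (∀ x, x ∉ fvA v.head → θ x = FirstOrder.Language.Term.var x) ∧
    (∀ e ∈ eqs (chr (S₁ ++ S₂)) (v.head.map (Atom.subst θ)), Entails CT (r.bi + r.guard) e) ∧
    (v.name, ids (S₁ ++ S₂)) ∉ r.tokens ∧
    D'' = v.guard.filter (fun c => ¬ Entails CT (r.bi + r.guard) (substF θ c)) ∧
    Satisfiable CT (r.guard + D''.map (substF θ)) ∧
    (B₁, T₁, m₁) = inst v.chr v.tokens (maxId r.chr r.tokens) ∧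
    r' =
      { name := r.name
        keep := r.keep
        remove := r.remove
        guard := r.guard + D''.map (substF θ)
        chr := K + ↑S₁ + B₁
        bi := r.bi + v.bi + ↑(eqs (chr (S₁ ++ S₂)) v.head)
        tokens :=
          if v.remove = [] then
            clean (K + ↑S₁) r.tokens ∪ T₁ ∪ {(v.name, ids S₁)}
          else clean (K + ↑S₁) r.tokens ∪ T₁ }

/-- `Unf_P(r)`: all rules obtained by unfolding `r` with a renamed apart rule of `P`. -/
def Unf (CT : L.Theory) (P : Set (Rule L Pr N)) (r : Rule L Pr N) : Set (Rule L Pr N) :=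
  {r' | ∃ v ∈ P, ∃ ρ : Equiv.Perm ℕ, Disjoint (v.rename ρ).fv r.fv ∧
    IsUnfolding CT r (v.rename ρ) r'}

/-- The rule `r` of `P` can be weakly safely replaced by its unfolded version in `P`: some
unfolding of `r` has a guard equivalent to that of `r`. -/
def WeaklySafelyReplaceable (CT : L.Theory) (P : Set (Rule L Pr N)) (r : Rule L Pr N) : Prop :=
  r ∈ P ∧ ∃ r' ∈ Unf CT P r, Equivalent CT r.guard r'.guard

end

end CHR

namespace CHR

open FirstOrder.Language

/-! ### Substitutions -/

section Subst

variable {L : FirstOrder.Language.{u, v}} {Pr : Type w} {N : Type w'}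

/-! The two programs are compared by a simulation in one direction; confluence and termination
supply the other.

A step of P' is copied by a normal computation of P between configurations whose built-in
constraints are all solved. A rule common to both programs is copied by itself. An application of an
unfolded rule is copied by applying r, solving, applying v, and solving again
(`IsUnfolding.applyWith`). The second application is possible because of Clark equality: the
equations between the matched constraints and the head of r determine the values of the head
variables (`ClarkEquality.eqs_unique`). Hence the valuation that witnesses the guard D, D''θ is the
one satisfying the new store, and that store entails everything the match of v by θ requires. The
two sides agree up to identifiers, tokens with absent identifiers, the solved/unsolved status of
constraints (`Sim`), and a renaming of variables (`SimUpTo`). Solving early is harmless, since a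
stronger store keeps rules applicable.

Final configurations of P' are simulated by final ones of P. Indeed a rule of P has a counterpart in
P' with the same name and head and an equivalent guard (for r, this is weak safe replaceability), so
a step of P on one side would give a step of P' on the other. Therefore every answer of P' is an
answer of P reached by a normal derivation (`exists_normalDerives_sameAnswer`). With P in both
roles, every answer of P itself comes from a normal derivation. Normal confluence makes all such
answers equal (`NormalConfluent.sameAnswer`), so P has at most one answer, and P' only has to have
some answer. Termination passes to P' (`Simulates.acc`), because each rule application costs P at
least one step and the Solve' steps between applications are bounded by the number of unsolved
constraints. -/

theorem term_subst_subst {α β γ : Type*} (t : L.Term α) (f : α → L.Term β) (g : β → L.Term γ) :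
    (t.subst f).subst g = t.subst fun a => (f a).subst g := by
  induction t with
  | var => rfl
  | func F ts ih => simp [Term.subst, ih]

theorem term_subst_var {α : Type*} (t : L.Term α) : t.subst Term.var = t := by
  induction t with
  | var => rfl
  | func F ts ih => simp [Term.subst, ih]

theorem term_subst_congr {α β : Type*} [DecidableEq α] (t : L.Term α) {f g : α → L.Term β}
    (h : ∀ x ∈ t.varFinset, f x = g x) : t.subst f = t.subst g := by
  induction t with
  | var a => exact h a (by simp)
  | func F ts ih =>
    simp only [Term.subst]
    congr 1
    funext i
    exact ih i fun x hx => h x (by simp only [Term.varFinset, Finset.mem_biUnion]; exact ⟨i, by simp, hx⟩)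

theorem term_realize_congr {M : Type*} [L.Structure M] {α : Type*} [DecidableEq α] (t : L.Term α)
    {f g : α → M} (h : ∀ x ∈ t.varFinset, f x = g x) : t.realize f = t.realize g := by
  induction t with
  | var a => exact h a (by simp)
  | func F ts ih =>
    simp only [Term.realize]
    congr 1
    funext i
    exact ih i fun x hx => h x (by simp only [Term.varFinset, Finset.mem_biUnion]; exact ⟨i, by simp, hx⟩)

theorem mem_varFinset_rename (ρ : Equiv.Perm ℕ) (t : L.Term ℕ) (x : ℕ) :
    x ∈ (t.subst (renSubst ρ)).varFinset ↔ ρ.symm x ∈ t.varFinset := by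
  induction t with
  | var a => simp [renSubst, Term.subst, Equiv.symm_apply_eq]
  | func F ts ih => simp [Term.subst, ih]

theorem renSubst_one : (renSubst 1 : ℕ → L.Term ℕ) = Term.var := rfl

theorem renSubst_mul (κ ρ : Equiv.Perm ℕ) :
    (fun a => ((renSubst ρ a : L.Term ℕ)).subst (renSubst κ)) = renSubst (κ * ρ) := rfl

/-- The substitution used by `BoundedFormula.subst` under `n` bound variables. -/
def liftSubst (θ : ℕ → L.Term ℕ) (n : ℕ) : ℕ ⊕ Fin n → L.Term (ℕ ⊕ Fin n) :=
  Sum.elim (Term.relabel Sum.inl ∘ θ) (Term.var ∘ Sum.inr)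

theorem liftSubst_mul (κ ρ : Equiv.Perm ℕ) (n : ℕ) :
    (fun a => (liftSubst (renSubst ρ : ℕ → L.Term ℕ) n a).subst (liftSubst (renSubst κ) n)) =
      liftSubst (renSubst (κ * ρ)) n := by
  funext a
  cases a <;> rfl

theorem subst_eq_mapTermRel {n : ℕ} (φ : L.BoundedFormula ℕ n) (θ : ℕ → L.Term ℕ) :
    φ.subst θ = φ.mapTermRel (fun n t => t.subst (liftSubst θ n)) (fun _ => id) fun _ => id := rfl

theorem subst_subst_rename {n : ℕ} (φ : L.BoundedFormula ℕ n) (κ ρ : Equiv.Perm ℕ) :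
    (φ.subst (renSubst ρ)).subst (renSubst κ) = φ.subst (renSubst (κ * ρ)) := by
  simp only [subst_eq_mapTermRel]
  rw [BoundedFormula.mapTermRel_mapTermRel]
  congr 1
  funext n t
  simp only [Function.comp, term_subst_subst, liftSubst_mul]

theorem subst_var {n : ℕ} (φ : L.BoundedFormula ℕ n) : φ.subst Term.var = φ := by
  rw [subst_eq_mapTermRel]
  have : (fun n (t : L.Term (ℕ ⊕ Fin n)) => t.subst (liftSubst Term.var n)) = fun _ => id := by
    funext n t
    have : liftSubst (L := L) Term.var n = Term.var := by
      funext a; cases a <;> rfl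
    rw [this, term_subst_var]; rfl
  rw [this, BoundedFormula.mapTermRel_id_id_id]

theorem varFinsetLeft_rename {n : ℕ} (ρ : Equiv.Perm ℕ) (t : L.Term (ℕ ⊕ Fin n)) (x : ℕ) :
    x ∈ (t.subst (liftSubst (renSubst ρ) n)).varFinsetLeft ↔ ρ.symm x ∈ t.varFinsetLeft := by
  induction t with
  | var a => cases a <;> simp [renSubst, Term.subst, liftSubst, Equiv.symm_apply_eq]
  | func F ts ih => simp [Term.subst, ih]

theorem termLeft_subst_congr {n : ℕ} (t : L.Term (ℕ ⊕ Fin n)) {f g : ℕ → L.Term ℕ}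
    (h : ∀ x ∈ t.varFinsetLeft, f x = g x) : t.subst (liftSubst f n) = t.subst (liftSubst g n) := by
  induction t with
  | var a =>
    cases a with
    | inl a => simp [Term.subst, liftSubst, h a (by simp)]
    | inr a => rfl
  | func F ts ih =>
    simp only [Term.subst]
    congr 1
    funext i
    exact ih i fun x hx => h x (by simp only [Term.varFinsetLeft, Finset.mem_biUnion]; exact ⟨i, by simp, hx⟩)

theorem mem_freeVarFinset_rename {n : ℕ} (ρ : Equiv.Perm ℕ) (φ : L.BoundedFormula ℕ n) (x : ℕ) :
    x ∈ (φ.subst (renSubst ρ)).freeVarFinset ↔ ρ.symm x ∈ φ.freeVarFinset := by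
  rw [subst_eq_mapTermRel]
  induction φ with
  | falsum => simp [BoundedFormula.mapTermRel, BoundedFormula.freeVarFinset]
  | equal =>
    simp [BoundedFormula.mapTermRel, BoundedFormula.freeVarFinset, varFinsetLeft_rename]
  | rel => simp [BoundedFormula.mapTermRel, BoundedFormula.freeVarFinset, varFinsetLeft_rename]
  | imp _ _ ih1 ih2 =>
    simp [BoundedFormula.mapTermRel, BoundedFormula.freeVarFinset, ih1, ih2]
  | all _ ih => simpa [BoundedFormula.mapTermRel, BoundedFormula.freeVarFinset] using ih

theorem subst_congr {n : ℕ} (φ : L.BoundedFormula ℕ n) {f g : ℕ → L.Term ℕ}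
    (h : ∀ x ∈ φ.freeVarFinset, f x = g x) : φ.subst f = φ.subst g := by
  rw [subst_eq_mapTermRel, subst_eq_mapTermRel]
  induction φ with
  | falsum => rfl
  | equal s t =>
    simp only [BoundedFormula.freeVarFinset, Finset.mem_union] at h
    simp only [BoundedFormula.mapTermRel]
    rw [termLeft_subst_congr s fun x hx => h x (.inl hx),
      termLeft_subst_congr t fun x hx => h x (.inr hx)]
  | rel R ts =>
    simp only [BoundedFormula.freeVarFinset, Finset.mem_biUnion] at h
    simp only [BoundedFormula.mapTermRel]
    congr 1
    funext i
    exact termLeft_subst_congr _ fun x hx => h x ⟨i, by simp, hx⟩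
  | imp _ _ ih1 ih2 =>
    simp only [BoundedFormula.freeVarFinset, Finset.mem_union] at h
    simp only [BoundedFormula.mapTermRel]
    rw [ih1 fun x hx => h x (.inl hx), ih2 fun x hx => h x (.inr hx)]
  | all _ ih =>
    simp only [BoundedFormula.mapTermRel]
    rw [id, id, ih h]

/-! ### Built-in constraints: substitution, truth values and free variables -/

theorem IsBuiltin.subst {n : ℕ} {φ : L.BoundedFormula ℕ n} (h : IsBuiltin φ) (θ : ℕ → L.Term ℕ) :
    IsBuiltin (φ.subst θ) := by
  induction h with
  | tru => exact .tru
  | fls => exact .fls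
  | eq s t => exact .eq _ _
  | rel R ts => exact .rel R _
  | and _ _ h1 h2 => exact .and h1 h2
  | ex _ h => exact .ex h

theorem IsBuiltin.equal (s t : L.Term ℕ) : IsBuiltin (s.equal t) := .eq _ _

theorem IsBuiltin.conj {l : List (L.Formula ℕ)} (h : ∀ c ∈ l, IsBuiltin c) :
    IsBuiltin (CHR.conj l) := by
  induction l with
  | nil => exact .tru
  | cons c l ih =>
    simp only [List.mem_cons, forall_eq_or_imp] at h
    exact .and h.1 (ih h.2)

theorem substF_substF (κ ρ : Equiv.Perm ℕ) (c : L.Formula ℕ) :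
    substF (renSubst κ) (substF (renSubst ρ) c) = substF (renSubst (κ * ρ)) c :=
  subst_subst_rename c κ ρ

theorem substF_one (c : L.Formula ℕ) : substF (renSubst 1) c = c := subst_var c

theorem realize_substF {M : Type*} [L.Structure M] (θ : ℕ → L.Term ℕ) (c : L.Formula ℕ)
    (val : ℕ → M) : (substF θ c).Realize val ↔ c.Realize fun x => (θ x).realize val :=
  BoundedFormula.realize_subst

theorem realize_rename {M : Type*} [L.Structure M] (ρ : Equiv.Perm ℕ) (c : L.Formula ℕ)
    (val : ℕ → M) : (substF (renSubst ρ) c).Realize val ↔ c.Realize (val ∘ ρ) :=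
  realize_substF _ _ _

theorem realize_conj {M : Type*} [L.Structure M] (l : List (L.Formula ℕ)) (val : ℕ → M) :
    (conj l).Realize val ↔ ∀ c ∈ l, c.Realize val :=
  BoundedFormula.realize_foldr_inf l val default

theorem substF_equal (θ : ℕ → L.Term ℕ) (s t : L.Term ℕ) :
    substF θ (s.equal t) = (s.subst θ).equal (t.subst θ) := by
  have key : ∀ s : L.Term ℕ, (s.relabel (Sum.inl : ℕ → ℕ ⊕ Fin 0)).subst (liftSubst θ 0) =
      (s.subst θ).relabel Sum.inl := by
    intro s
    induction s with
    | var => rfl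
    | func F ts ih => simp [Term.subst, ih]
  exact congrArg₂ BoundedFormula.equal (key s) (key t)

theorem substF_inf (θ : ℕ → L.Term ℕ) (c d : L.Formula ℕ) :
    substF θ (c ⊓ d) = substF θ c ⊓ substF θ d := rfl

theorem substF_conj (θ : ℕ → L.Term ℕ) (l : List (L.Formula ℕ)) :
    substF θ (conj l) = conj (l.map (substF θ)) := by
  induction l with
  | nil => rfl
  | cons c l ih =>
    show substF θ (c ⊓ conj l) = _
    rw [substF_inf, ih]; rfl

theorem mem_freeVarFinset_equal (s t : L.Term ℕ) (x : ℕ) :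
    x ∈ BoundedFormula.freeVarFinset (s.equal t) ↔ x ∈ s.varFinset ∨ x ∈ t.varFinset := by
  have key : ∀ s : L.Term ℕ, (s.relabel (Sum.inl : ℕ → ℕ ⊕ Fin 0)).varFinsetLeft = s.varFinset := by
    intro s
    induction s with
    | var => rfl
    | func F ts ih => simp [ih]
  show x ∈ BoundedFormula.freeVarFinset (BoundedFormula.equal _ _) ↔ _
  simp only [BoundedFormula.freeVarFinset, Finset.mem_union]
  rw [← key s, ← key t]

theorem mem_freeVarFinset_inf (c d : L.Formula ℕ) (x : ℕ) :
    x ∈ BoundedFormula.freeVarFinset (c ⊓ d) ↔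
      x ∈ BoundedFormula.freeVarFinset c ∨ x ∈ BoundedFormula.freeVarFinset d := by
  show x ∈ BoundedFormula.freeVarFinset (BoundedFormula.imp (BoundedFormula.imp c
    (BoundedFormula.imp d BoundedFormula.falsum)) BoundedFormula.falsum) ↔ _
  simp [BoundedFormula.freeVarFinset]

theorem mem_freeVarFinset_conj (l : List (L.Formula ℕ)) (x : ℕ) :
    x ∈ BoundedFormula.freeVarFinset (conj l) ↔ ∃ c ∈ l, x ∈ BoundedFormula.freeVarFinset c := by
  induction l with
  | nil =>
    show x ∈ BoundedFormula.freeVarFinset (BoundedFormula.imp BoundedFormula.falsum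
      BoundedFormula.falsum) ↔ _
    simp [BoundedFormula.freeVarFinset]
  | cons c l ih =>
    show x ∈ BoundedFormula.freeVarFinset (c ⊓ conj l) ↔ _
    rw [mem_freeVarFinset_inf, ih]; simp

theorem iff_realize {CT : L.Theory} {c d : L.Formula ℕ} :
    CT.Iff c d ↔ ∀ (M : Model CT) (val : ℕ → M), c.Realize val ↔ d.Realize val := by
  constructor
  · intro h M val
    exact BoundedFormula.realize_iff.1 (h M val default)
  · intro h M val xs
    rw [BoundedFormula.realize_iff, Subsingleton.elim xs default]
    exact h M val

theorem iff_rename {CT : L.Theory} {c d : L.Formula ℕ} (ρ : Equiv.Perm ℕ) (h : CT.Iff c d) :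
    CT.Iff (substF (renSubst ρ) c) (substF (renSubst ρ) d) := by
  rw [iff_realize] at h ⊢
  intro M val
  rw [realize_rename, realize_rename, h]

theorem inconsistent_iff {CT : L.Theory} {c : L.Formula ℕ} :
    Inconsistent CT c ↔ ∀ (M : Model CT) (val : ℕ → M), ¬ c.Realize val := by
  rw [Inconsistent, iff_realize]
  simp

theorem inconsistent_rename {CT : L.Theory} {c : L.Formula ℕ} (ρ : Equiv.Perm ℕ) :
    Inconsistent CT (substF (renSubst ρ) c) ↔ Inconsistent CT c := by
  rw [inconsistent_iff, inconsistent_iff]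
  constructor
  · intro h M val hc
    refine h M (val ∘ ρ.symm) ((realize_rename _ _ _).2 ?_)
    rwa [Function.comp_assoc, Equiv.symm_comp_self, Function.comp_id]
  · intro h M val hc
    exact h M _ ((realize_rename _ _ _).1 hc)

/-! #### Finite sets of variables -/

theorem finite_atom_fv (a : Atom L Pr) : a.fv.Finite := by
  have : a.fv = ⋃ t ∈ {t | t ∈ a.args}, (t.varFinset : Set ℕ) := by
    ext x; simp [Atom.fv]
  rw [this]
  exact (List.finite_toSet _).biUnion fun t _ => t.varFinset.finite_toSet

theorem finite_fvA (H : List (Atom L Pr)) : (fvA H).Finite := by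
  have : fvA H = ⋃ a ∈ {a | a ∈ H}, a.fv := by
    ext x; simp [fvA]
  rw [this]
  exact (List.finite_toSet _).biUnion fun t _ => finite_atom_fv t

theorem finite_fvI (B : Multiset (IdAtom L Pr)) : (fvI B).Finite := by
  have : fvI B = ⋃ a ∈ {a | a ∈ B}, a.1.fv := by
    ext x; simp [fvI]
  rw [this]
  exact (Multiset.finite_toSet _).biUnion fun t _ => finite_atom_fv _

theorem finite_fvF (Γ : Multiset (L.Formula ℕ)) : (fvF Γ).Finite := by
  have : fvF Γ = ⋃ c ∈ {c | c ∈ Γ}, (BoundedFormula.freeVarFinset c : Set ℕ) := by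
    ext x; simp [fvF]
  rw [this]
  exact (Multiset.finite_toSet _).biUnion fun t _ => Finset.finite_toSet _

theorem Rule.finite_fv (r : Rule L Pr N) : r.fv.Finite :=
  (((finite_fvA _).union (finite_fvF _)).union (finite_fvI _)).union (finite_fvF _)

theorem State.finite_fv (σ : State L Pr N) : σ.fv.Finite :=
  ((finite_fvI _).union (finite_fvF _)).union (finite_fvF _)

theorem Goal.finite_fv (G : Goal L Pr) : G.fv.Finite := (finite_fvA _).union (finite_fvF _)

/-- Finitely many points can be moved off a finite set by a permutation that fixes finitely many
other points. -/
theorem exists_perm_avoiding {A W F : Set ℕ} (hA : A.Finite) (hW : W.Finite) (hF : F.Finite)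
    (hAW : Disjoint A W) :
    ∃ κ : Equiv.Perm ℕ, (∀ x ∈ A, κ x = x) ∧ ∀ x ∈ W, κ x ∉ F := by
  classical
  obtain ⟨b, hb⟩ := ((hA.union hW).union hF).bddAbove
  have hlt : ∀ x, x ∈ A ∪ W ∪ F → x < b + 1 := fun x hx => Nat.lt_succ_of_le (hb hx)
  -- With `b` a bound for all three sets, the involution exchanges each `x ∈ W` with `x + (b + 1)`,
  -- which lies beyond them; so `A` stays fixed and `W` leaves `F`.
  let f : ℕ → ℕ := fun x => if x ∈ W then x + (b + 1)
    else if b + 1 ≤ x ∧ x - (b + 1) ∈ W then x - (b + 1) else x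
  have hf : Function.Involutive f := by
    intro x
    by_cases h1 : x ∈ W
    · have h2 : x + (b + 1) ∉ W := fun h => by
        have := hlt _ (.inl (.inr h)); omega
      simp only [f, h1, h2, if_true, if_false]
      rw [if_pos ⟨by omega, by simpa using h1⟩]
      omega
    · by_cases h2 : b + 1 ≤ x ∧ x - (b + 1) ∈ W
      · have h3 : f x = x - (b + 1) := by simp only [f, h1, if_false, h2, and_self, if_true]
        rw [h3]
        simp only [f, h2.2, if_true]
        omega
      · have h3 : f x = x := by simp only [f, h1, if_false, h2]
        rw [h3, h3]
  refine ⟨hf.toPerm, fun x hx => ?_, fun x hx hxF => ?_⟩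
  · have h1 : x ∉ W := fun h => Set.disjoint_left.1 hAW hx h
    have h2 : ¬ (b + 1 ≤ x ∧ x - (b + 1) ∈ W) := fun h => by
      have := hlt _ (.inl (.inl hx)); omega
    show f x = x
    simp only [f, h1, if_false, h2]
  · have : f x ∈ F := hxF
    simp only [f, hx, if_true] at this
    have := hlt _ (.inr this); omega

end Subst

/-! ### Renaming of variables -/

section Rename

variable {L : FirstOrder.Language.{u, v}} {Pr : Type w} {N : Type w'}

theorem Atom.subst_subst (κ ρ : Equiv.Perm ℕ) (a : Atom L Pr) :
    (a.subst (renSubst ρ)).subst (renSubst κ) = a.subst (renSubst (κ * ρ)) := by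
  simp [Atom.subst, term_subst_subst, renSubst_mul]

theorem Atom.subst_one (a : Atom L Pr) : a.subst (renSubst 1) = a := by
  simp [Atom.subst, renSubst_one, term_subst_var]

theorem Atom.subst_congr (a : Atom L Pr) {f g : ℕ → L.Term ℕ} (h : ∀ x ∈ a.fv, f x = g x) :
    a.subst f = a.subst g := by
  simp only [Atom.subst, Atom.mk.injEq, true_and]
  exact List.map_congr_left fun t ht => term_subst_congr t fun x hx => h x ⟨t, ht, hx⟩

theorem Atom.fv_rename (ρ : Equiv.Perm ℕ) (a : Atom L Pr) :
    (a.subst (renSubst ρ)).fv = ρ '' a.fv := by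
  ext x
  simp [Atom.fv, Atom.subst, mem_varFinset_rename, Equiv.image_eq_preimage_symm]

theorem fvA_rename (ρ : Equiv.Perm ℕ) (H : List (Atom L Pr)) :
    fvA (H.map (Atom.subst (renSubst ρ))) = ρ '' fvA H := by
  ext x
  simp [fvA, Atom.fv_rename, Equiv.image_eq_preimage_symm]

theorem fvF_rename (ρ : Equiv.Perm ℕ) (Γ : Multiset (L.Formula ℕ)) :
    fvF (Γ.map (substF (renSubst ρ))) = ρ '' fvF Γ := by
  ext x
  simp only [fvF, Multiset.mem_map, exists_exists_and_eq_and, Set.mem_ofPred_eq,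
    Equiv.image_eq_preimage_symm, Set.mem_preimage]
  exact exists_congr fun c => and_congr_right fun _ => mem_freeVarFinset_rename ρ c x

/-- Renaming of the variables of an identified constraint. -/
def renameI (ρ : Equiv.Perm ℕ) (a : IdAtom L Pr) : IdAtom L Pr := (a.1.subst (renSubst ρ), a.2)

theorem renameI_renameI (κ ρ : Equiv.Perm ℕ) (a : IdAtom L Pr) :
    renameI κ (renameI ρ a) = renameI (κ * ρ) a := by
  simp [renameI, Atom.subst_subst]

theorem renameI_one (a : IdAtom L Pr) : renameI 1 a = a := by
  simp [renameI, Atom.subst_one]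

theorem fvI_rename (ρ : Equiv.Perm ℕ) (B : Multiset (IdAtom L Pr)) :
    fvI (B.map (renameI ρ)) = ρ '' fvI B := by
  ext x
  simp only [fvI, renameI, Multiset.mem_map, exists_exists_and_eq_and, Atom.fv_rename,
    Equiv.image_eq_preimage_symm, Set.mem_preimage, Set.mem_ofPred_eq]

theorem idSet_rename (ρ : Equiv.Perm ℕ) (B : Multiset (IdAtom L Pr)) :
    idSet (B.map (renameI ρ)) = idSet B := by
  ext x
  simp [idSet, renameI]

theorem chr_rename (ρ : Equiv.Perm ℕ) (H : List (IdAtom L Pr)) :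
    chr (H.map (renameI ρ)) = (chr H).map (Atom.subst (renSubst ρ)) := by
  simp [chr, renameI]

theorem ids_rename (ρ : Equiv.Perm ℕ) (H : List (IdAtom L Pr)) :
    ids (H.map (renameI ρ)) = ids H := by
  simp [ids, renameI]

theorem shiftI_rename (ρ : Equiv.Perm ℕ) (n : ℕ) (B : Multiset (IdAtom L Pr)) :
    shiftI n (B.map (renameI ρ)) = (shiftI n B).map (renameI ρ) := by
  simp [shiftI, renameI, Function.comp_def]

theorem maxId_rename (ρ : Equiv.Perm ℕ) (B : Multiset (IdAtom L Pr)) (T : Set (Token N)) :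
    maxId (B.map (renameI ρ)) T = maxId B T := by
  rw [maxId, maxId, idSet_rename]

theorem map_id_rename (ρ : Equiv.Perm ℕ) (B : Multiset (IdAtom L Pr)) :
    (B.map (renameI ρ)).map Prod.snd = B.map Prod.snd := by
  simp [renameI, Function.comp_def]

/-! ### Equations between heads, and entailment under renaming -/

theorem comparable_rename (κ : Equiv.Perm ℕ) {H H' : List (Atom L Pr)} (h : Comparable H H') :
    Comparable (H.map (Atom.subst (renSubst κ))) (H'.map (Atom.subst (renSubst κ))) := by
  unfold Comparable at *
  rw [List.forall₂_map_left_iff, List.forall₂_map_right_iff]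
  exact h.imp fun a b h => by simpa [Atom.subst] using h

theorem eqs_subst (θ : ℕ → L.Term ℕ) (H H' : List (Atom L Pr)) :
    (eqs H H').map (substF θ) = eqs (H.map (Atom.subst θ)) (H'.map (Atom.subst θ)) := by
  simp [eqs, List.map_flatten, List.map_zipWith, List.zipWith_map, substF_equal, Atom.subst]

theorem mem_eqs {H H' : List (Atom L Pr)} {c : L.Formula ℕ} :
    c ∈ eqs H H' ↔ ∃ p ∈ H.zip H', ∃ q ∈ p.1.args.zip p.2.args, c = q.1.equal q.2 := by
  simp only [eqs, List.mem_flatten, ← List.map_uncurry_zip_eq_zipWith, List.mem_map,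
    Function.uncurry]
  constructor
  · rintro ⟨_, ⟨p, hp, rfl⟩, hc⟩
    obtain ⟨q, hq, rfl⟩ := List.mem_map.1 hc
    exact ⟨p, hp, q, hq, rfl⟩
  · rintro ⟨p, hp, q, hq, rfl⟩
    exact ⟨_, ⟨p, hp, rfl⟩, List.mem_map.2 ⟨q, hq, rfl⟩⟩

theorem eqs_builtin {H H' : List (Atom L Pr)} {c : L.Formula ℕ} (h : c ∈ eqs H H') :
    IsBuiltin c := by
  obtain ⟨p, _, q, _, rfl⟩ := mem_eqs.1 h
  exact .equal _ _

theorem fvF_eqs_subset (H H' : List (Atom L Pr)) :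
    fvF (↑(eqs H H') : Multiset (L.Formula ℕ)) ⊆ fvA H ∪ fvA H' := by
  rintro x ⟨c, hc, hx⟩
  obtain ⟨p, hp, q, hq, rfl⟩ := mem_eqs.1 (Multiset.mem_coe.1 hc)
  rw [mem_freeVarFinset_equal] at hx
  have hp' := List.of_mem_zip (show (p.1, p.2) ∈ _ from hp)
  have hq' := List.of_mem_zip (show (q.1, q.2) ∈ _ from hq)
  exact hx.imp (fun hx => ⟨p.1, hp'.1, q.1, hq'.1, hx⟩) fun hx => ⟨p.2, hp'.2, q.2, hq'.2, hx⟩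

theorem fvI_add (B B' : Multiset (IdAtom L Pr)) : fvI (B + B') = fvI B ∪ fvI B' := by
  ext x; simp only [fvI, Multiset.mem_add, Set.mem_ofPred_eq, Set.mem_union, or_and_right, exists_or]

theorem idSet_add (B B' : Multiset (IdAtom L Pr)) : idSet (B + B') = idSet B ∪ idSet B' := by
  ext x; simp only [idSet, Multiset.mem_add, Set.mem_ofPred_eq, Set.mem_union, or_and_right, exists_or]

theorem idSet_coe (H : List (IdAtom L Pr)) : idSet (↑H : Multiset (IdAtom L Pr)) = {i | i ∈ ids H} := by
  ext x; simp [idSet, ids]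

theorem fvI_coe (H : List (IdAtom L Pr)) : fvI (↑H : Multiset (IdAtom L Pr)) = fvA (chr H) := by
  ext x; simp [fvI, fvA, chr]

theorem fvI_shiftI (n : ℕ) (B : Multiset (IdAtom L Pr)) : fvI (shiftI n B) = fvI B := by
  ext x; simp [fvI, shiftI]

theorem chr_append (H H' : List (IdAtom L Pr)) : chr (H ++ H') = chr H ++ chr H' := by
  simp [chr]

theorem ids_append (H H' : List (IdAtom L Pr)) : ids (H ++ H') = ids H ++ ids H' := by
  simp [ids]

theorem holds_add {M : Type*} [L.Structure M] {Γ Δ : Multiset (L.Formula ℕ)} {val : ℕ → M} :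
    Holds (Γ + Δ) val ↔ Holds Γ val ∧ Holds Δ val := by
  simp [Holds, or_imp, forall_and]

theorem holds_cons {M : Type*} [L.Structure M] {c : L.Formula ℕ} {Δ : Multiset (L.Formula ℕ)}
    {val : ℕ → M} : Holds (c ::ₘ Δ) val ↔ c.Realize val ∧ Holds Δ val := by
  simp [Holds]

theorem holds_zero {M : Type*} [L.Structure M] {val : ℕ → M} :
    Holds (0 : Multiset (L.Formula ℕ)) val := by
  simp [Holds]

theorem holds_map {M : Type*} [L.Structure M] {Γ : Multiset (L.Formula ℕ)} {θ : ℕ → L.Term ℕ}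
    {val : ℕ → M} : Holds (Γ.map (substF θ)) val ↔ Holds Γ fun x => (θ x).realize val := by
  simp [Holds, realize_substF]

theorem EntailsExists.rename {CT : L.Theory} {c : L.Formula ℕ} {x : Set ℕ}
    {Γ : Multiset (L.Formula ℕ)} (h : EntailsExists CT c x Γ) (κ : Equiv.Perm ℕ) :
    EntailsExists CT (substF (renSubst κ) c) (κ '' x) (Γ.map (substF (renSubst κ))) := by
  intro M val hc
  obtain ⟨val', h1, h2⟩ := h M _ ((realize_rename _ _ _).1 hc)
  refine ⟨val' ∘ κ.symm, fun y hy => ?_, holds_map.2 ?_⟩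
  · rw [Function.comp_apply, h1, Function.comp_apply, Equiv.apply_symm_apply]
    intro h'
    exact hy ⟨_, h', by simp⟩
  · convert h2 using 1
    funext x
    simp [renSubst]

/-! #### Rules -/

namespace Rule

theorem rename_rename (κ ρ : Equiv.Perm ℕ) (r : Rule L Pr N) :
    (r.rename ρ).rename κ = r.rename (κ * ρ) := by
  simp only [rename, List.map_map, Multiset.map_map, mk.injEq, true_and, and_true]
  refine ⟨?_, ?_, ?_, ?_, ?_⟩ <;> congr 1 <;> funext a <;>
    simp [Atom.subst_subst, substF_substF]

theorem rename_one (r : Rule L Pr N) : r.rename 1 = r := by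
  have h1 : (Atom.subst (renSubst 1) : Atom L Pr → Atom L Pr) = id := funext Atom.subst_one
  have h2 : (substF (renSubst 1) : L.Formula ℕ → L.Formula ℕ) = id := funext substF_one
  cases r
  simp [rename, h1, h2]

theorem head_rename (ρ : Equiv.Perm ℕ) (r : Rule L Pr N) :
    (r.rename ρ).head = r.head.map (Atom.subst (renSubst ρ)) := by
  simp [head, rename]

theorem chr_rename (ρ : Equiv.Perm ℕ) (r : Rule L Pr N) :
    (r.rename ρ).chr = r.chr.map (renameI ρ) := rfl

theorem fv_rename (ρ : Equiv.Perm ℕ) (r : Rule L Pr N) : (r.rename ρ).fv = ρ '' r.fv := by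
  simp only [fv, head_rename, fvA_rename, chr_rename, fvI_rename, Set.image_union]
  simp only [rename, fvF_rename]

theorem rename_congr (r : Rule L Pr N) {ρ ρ' : Equiv.Perm ℕ} (h : ∀ x ∈ r.fv, ρ x = ρ' x) :
    r.rename ρ = r.rename ρ' := by
  have h' : ∀ x ∈ r.fv, (renSubst ρ x : L.Term ℕ) = renSubst ρ' x := fun x hx => by
    simp [renSubst, h x hx]
  simp only [rename, mk.injEq, true_and, and_true]
  refine ⟨List.map_congr_left fun a ha => ?_, List.map_congr_left fun a ha => ?_,
    Multiset.map_congr rfl fun c hc => ?_, Multiset.map_congr rfl fun a ha => ?_,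
    Multiset.map_congr rfl fun c hc => ?_⟩
  · exact a.subst_congr fun x hx => h' x (.inl (.inl (.inl ⟨a, by simp [head, ha], hx⟩)))
  · exact a.subst_congr fun x hx => h' x (.inl (.inl (.inl ⟨a, by simp [head, ha], hx⟩)))
  · exact subst_congr c fun x hx => h' x (.inl (.inl (.inr ⟨c, hc, hx⟩)))
  · rw [a.1.subst_congr fun x hx => h' x (.inl (.inr ⟨a, ha, hx⟩))]
  · exact subst_congr c fun x hx => h' x (.inr ⟨c, hc, hx⟩)

theorem WF.rename {r : Rule L Pr N} (h : r.WF) (ρ : Equiv.Perm ℕ) : (r.rename ρ).WF where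
  head_ne := by rw [head_rename]; simpa using h.head_ne
  guard_builtin c hc := by
    obtain ⟨d, hd, rfl⟩ := Multiset.mem_map.1 hc
    exact (h.guard_builtin d hd).subst _
  bi_builtin c hc := by
    obtain ⟨d, hd, rfl⟩ := Multiset.mem_map.1 hc
    exact (h.bi_builtin d hd).subst _
  nodup := by rw [chr_rename, map_id_rename]; exact h.nodup
  pos := by rw [chr_rename, idSet_rename]; exact h.pos
  tokens_sub := by rw [chr_rename, idSet_rename]; exact h.tokens_sub

end Rule

/-! #### Configurations -/

namespace State

/-- Renaming of the variables of a configuration. -/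
def rename (ρ : Equiv.Perm ℕ) (σ : State L Pr N) : State L Pr N :=
  ⟨σ.chr.map (renameI ρ), σ.bi.map (substF (renSubst ρ)), substF (renSubst ρ) σ.store, σ.tokens,
    σ.cnt⟩

theorem rename_rename (κ ρ : Equiv.Perm ℕ) (σ : State L Pr N) :
    (σ.rename ρ).rename κ = σ.rename (κ * ρ) := by
  simp only [rename, Multiset.map_map, mk.injEq, and_true, substF_substF]
  refine ⟨?_, ?_⟩ <;> congr 1 <;> funext a <;> simp [renameI_renameI, substF_substF]

theorem rename_one (σ : State L Pr N) : σ.rename 1 = σ := by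
  have h1 : (renameI 1 : IdAtom L Pr → IdAtom L Pr) = id := funext renameI_one
  have h2 : (substF (renSubst 1) : L.Formula ℕ → L.Formula ℕ) = id := funext substF_one
  cases σ
  simp [rename, h1, h2]

theorem fv_rename (ρ : Equiv.Perm ℕ) (σ : State L Pr N) : (σ.rename ρ).fv = ρ '' σ.fv := by
  have h := fvF_rename ρ {σ.store}
  rw [Multiset.map_singleton] at h
  simp only [fv, rename, fvI_rename, fvF_rename, Set.image_union, h]

theorem rename_congr (σ : State L Pr N) {ρ ρ' : Equiv.Perm ℕ} (h : ∀ x ∈ σ.fv, ρ x = ρ' x) :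
    σ.rename ρ = σ.rename ρ' := by
  have h' : ∀ x ∈ σ.fv, (renSubst ρ x : L.Term ℕ) = renSubst ρ' x := fun x hx => by
    simp [renSubst, h x hx]
  simp only [rename, mk.injEq, and_true]
  refine ⟨Multiset.map_congr rfl fun a ha => ?_, Multiset.map_congr rfl fun c hc => ?_, ?_⟩
  · rw [renameI, a.1.subst_congr fun x hx => h' x (.inl (.inl ⟨a, ha, hx⟩))]; rfl
  · exact subst_congr c fun x hx => h' x (.inl (.inr ⟨c, hc, hx⟩))
  · exact subst_congr σ.store fun x hx => h' x (.inr ⟨σ.store, by simp, hx⟩)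

theorem WF.rename {σ : State L Pr N} (h : σ.WF) (ρ : Equiv.Perm ℕ) : (σ.rename ρ).WF where
  bi_builtin c hc := by
    obtain ⟨d, hd, rfl⟩ := Multiset.mem_map.1 hc
    exact (h.bi_builtin d hd).subst _
  store_builtin := h.store_builtin.subst _
  nodup := by rw [State.rename, map_id_rename]; exact h.nodup
  pos := by rw [State.rename, idSet_rename]; exact h.pos
  chr_le := by rw [State.rename, idSet_rename]; exact h.chr_le
  tokens_le := h.tokens_le

theorem failed_rename {CT : L.Theory} {σ : State L Pr N} (ρ : Equiv.Perm ℕ) :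
    (σ.rename ρ).Failed CT ↔ σ.Failed CT := inconsistent_rename ρ

end State

/-! #### Transitions -/

/-- The transition Apply' with a given rule, which is already renamed apart. -/
def ApplyWith (CT : L.Theory) (r : Rule L Pr N) (V : Set ℕ) (σ τ : State L Pr N) : Prop :=
  ∃ (H₁ H₂ : List (IdAtom L Pr)) (K : Multiset (IdAtom L Pr)),
    σ.chr = ↑H₁ + ↑H₂ + K ∧ Disjoint r.fv (V ∪ σ.fv) ∧
    Comparable (chr H₁) r.keep ∧ Comparable (chr H₂) r.remove ∧
    EntailsExists CT σ.store (fvA r.head) (↑(eqs (chr (H₁ ++ H₂)) r.head) + r.guard) ∧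
    (r.name, ids (H₁ ++ H₂)) ∉ σ.tokens ∧
    τ = ⟨shiftI σ.cnt r.chr + ↑H₁ + K, r.bi + σ.bi,
      conj (eqs (chr (H₁ ++ H₂)) r.head) ⊓ σ.store,
      σ.tokens ∪ {t | H₂ = [] ∧ t = (r.name, ids (H₁ ++ H₂))} ∪ shiftT σ.cnt r.tokens,
      σ.cnt + maxId r.chr r.tokens⟩

/-- A working form of the transition: `inst` is evaluated, and the propagation token becomes a set
that is empty unless `H₂ = []`, which avoids a case split later. -/
theorem apply_iff {CT : L.Theory} {P : Set (Rule L Pr N)} {V : Set ℕ} {σ τ : State L Pr N} :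
    Apply CT P V σ τ ↔ ∃ r ∈ P, ∃ ρ : Equiv.Perm ℕ, ApplyWith CT (r.rename ρ) V σ τ := by
  constructor
  · rintro ⟨r₀, hr₀, ρ, r, rfl, H₁, H₂, K, B, C, T, n, hfresh, hkeep, hremove, hent, htoken, B', T',
      m, hinst⟩
    simp only [inst, Prod.mk.injEq] at hinst
    obtain ⟨rfl, rfl, rfl⟩ := hinst
    refine ⟨r₀, hr₀, ρ, H₁, H₂, K, rfl, hfresh, hkeep, hremove, hent, htoken, ?_⟩
    congr 1
    ext t
    split_ifs with h <;> simp [h]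
  · rintro ⟨r₀, hr₀, ρ, H₁, H₂, K, hchr, hfresh, hkeep, hremove, hent, htoken, rfl⟩
    obtain ⟨S, B, C, T, n⟩ := σ
    obtain rfl : S = _ := hchr
    have h := Apply.intro (CT := CT) (P := P) (V := V) r₀ hr₀ ρ _ rfl H₁ H₂ K B C T n hfresh hkeep
      hremove hent htoken _ _ _ rfl
    convert h using 2
    ext t
    split_ifs with h <;> simp [h]

/-- Every ingredient of an application is equivariant under permutations of variables, so apartness
can be arranged by renaming the configuration instead of the rule. -/
theorem ApplyWith.rename {CT : L.Theory} {r : Rule L Pr N} {V : Set ℕ} {σ τ : State L Pr N}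
    (h : ApplyWith CT r V σ τ) (κ : Equiv.Perm ℕ) :
    ApplyWith CT (r.rename κ) (κ '' V) (σ.rename κ) (τ.rename κ) := by
  obtain ⟨H₁, H₂, K, hchr, hfresh, hkeep, hremove, hent, htoken, rfl⟩ := h
  have hH : chr (H₁.map (renameI κ) ++ H₂.map (renameI κ)) =
      (chr (H₁ ++ H₂)).map (Atom.subst (renSubst κ)) := by
    rw [← List.map_append, chr_rename]
  have hids : ids (H₁.map (renameI κ) ++ H₂.map (renameI κ)) = ids (H₁ ++ H₂) := by
    rw [← List.map_append, ids_rename]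
  refine ⟨H₁.map (renameI κ), H₂.map (renameI κ), K.map (renameI κ), ?_, ?_, ?_, ?_, ?_, ?_, ?_⟩
  · simp [State.rename, hchr]
  · rw [Rule.fv_rename, State.fv_rename, ← Set.image_union]
    exact (Set.disjoint_image_iff κ.injective).2 hfresh
  · rw [chr_rename]; exact comparable_rename κ hkeep
  · rw [chr_rename]; exact comparable_rename κ hremove
  · rw [Rule.head_rename, hH, ← eqs_subst, fvA_rename]
    have := hent.rename κ
    rwa [Multiset.map_add, Multiset.map_coe] at this
  · rw [hids]; exact htoken
  · simp only [State.rename, State.mk.injEq, hids, Rule.chr_rename, shiftI_rename, maxId_rename, hH,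
      Rule.head_rename, ← eqs_subst, substF_inf, substF_conj]
    refine ⟨?_, ?_, trivial, ?_, rfl⟩
    · simp
    · simp [Rule.rename]
    · simp [Rule.rename]

theorem Apply.rename {CT : L.Theory} {P : Set (Rule L Pr N)} {V : Set ℕ} {σ τ : State L Pr N}
    (h : Apply CT P V σ τ) (κ : Equiv.Perm ℕ) :
    Apply CT P (κ '' V) (σ.rename κ) (τ.rename κ) := by
  rw [apply_iff] at h ⊢
  obtain ⟨r, hr, ρ, h⟩ := h
  refine ⟨r, hr, κ * ρ, ?_⟩
  rw [← Rule.rename_rename]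
  exact h.rename κ

theorem Solve.rename {CT : L.Theory} {σ τ : State L Pr N} (h : Solve CT σ τ) (κ : Equiv.Perm ℕ) :
    Solve CT (σ.rename κ) (τ.rename κ) := by
  obtain ⟨K, B, c, C, C', T, n, hC', h⟩ := h
  simp only [State.rename, Multiset.map_cons]
  exact .intro _ _ _ _ _ _ _ (hC'.subst _) (iff_rename κ h)

theorem State.builtinFree_rename {CT : L.Theory} {σ : State L Pr N} (ρ : Equiv.Perm ℕ)
    (h : σ.BuiltinFree CT) : (σ.rename ρ).BuiltinFree CT :=
  h.imp (State.failed_rename ρ).2 fun h => by simp [State.rename, h]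

theorem NormalStep.rename {CT : L.Theory} {P : Set (Rule L Pr N)} {V : Set ℕ} {σ τ : State L Pr N}
    (h : NormalStep CT P V σ τ) (κ : Equiv.Perm ℕ) :
    NormalStep CT P (κ '' V) (σ.rename κ) (τ.rename κ) :=
  h.imp (fun h => h.rename κ) fun h => ⟨State.builtinFree_rename κ h.1, h.2.rename κ⟩

end Rename

/-! ### Invariants of computations -/

section Invariants

variable {L : FirstOrder.Language.{u, v}} {Pr : Type w} {N : Type w'}

theorem finite_idSet (B : Multiset (IdAtom L Pr)) : (idSet B).Finite := by
  have : idSet B = Prod.snd '' {a | a ∈ B} := by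
    ext x; simp [idSet]
  rw [this]
  exact (Multiset.finite_toSet _).image _

/-- The supremum in `maxId` is meaningful only for a bounded set; tokens mention only identifiers of
the body, so the set is finite. -/
theorem le_maxId {B : Multiset (IdAtom L Pr)} {T : Set (Token N)} (h : tokenIds T ⊆ idSet B)
    {i : ℕ} (hi : i ∈ idSet B) : i ≤ maxId B T :=
  le_csSup ((finite_idSet B).union ((finite_idSet B).subset h)).bddAbove (.inl hi)

theorem mem_idSet_shiftI {n i : ℕ} {B : Multiset (IdAtom L Pr)} :
    i ∈ idSet (shiftI n B) ↔ ∃ j ∈ idSet B, j + n = i := by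
  simp only [idSet, shiftI, Multiset.mem_map, exists_exists_and_eq_and, Set.mem_ofPred_eq]

theorem mem_idSet {i : ℕ} {B : Multiset (IdAtom L Pr)} : i ∈ idSet B ↔ i ∈ B.map Prod.snd := by
  simp [idSet]

/-- Body identifiers are positive, so after the shift they exceed the counter and hence every
identifier in use. -/
theorem ApplyWith.wf {CT : L.Theory} {r : Rule L Pr N} {V : Set ℕ} {σ τ : State L Pr N}
    (h : ApplyWith CT r V σ τ) (hr : r.WF) (hσ : σ.WF) : τ.WF := by
  obtain ⟨H₁, H₂, K, hchr, hfresh, hkeep, hremove, hent, htoken, rfl⟩ := h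
  have hnd := hσ.nodup
  rw [hchr, Multiset.map_add, Multiset.map_add] at hnd
  have hH₁ : ∀ i ∈ idSet (↑H₁ : Multiset (IdAtom L Pr)), i ∈ idSet σ.chr := fun i hi => by
    rw [hchr, idSet_add, idSet_add]; exact .inl (.inl hi)
  have hH₂ : ∀ i ∈ idSet (↑H₂ : Multiset (IdAtom L Pr)), i ∈ idSet σ.chr := fun i hi => by
    rw [hchr, idSet_add, idSet_add]; exact .inl (.inr hi)
  have hK : ∀ i ∈ idSet K, i ∈ idSet σ.chr := fun i hi => by
    rw [hchr, idSet_add, idSet_add]; exact .inr hi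
  constructor
  · intro c hc
    rcases Multiset.mem_add.1 hc with hc | hc
    exacts [hr.bi_builtin c hc, hσ.bi_builtin c hc]
  · exact .and (.conj fun c hc => eqs_builtin hc) hσ.store_builtin
  · simp only [Multiset.map_add, add_assoc]
    rw [Multiset.nodup_add]
    refine ⟨?_, ?_, ?_⟩
    · have : (shiftI σ.cnt r.chr).map Prod.snd = (r.chr.map Prod.snd).map (· + σ.cnt) := by
        simp [shiftI]
      rw [this]
      exact hr.nodup.map (add_left_injective _)
    · refine Multiset.nodup_of_le ?_ hnd
      rw [add_right_comm]
      exact Multiset.le_add_right _ _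
    · rw [Multiset.disjoint_left]
      intro i hi hi'
      rw [← Multiset.map_add, ← mem_idSet, idSet_add] at hi'
      rw [← mem_idSet, mem_idSet_shiftI] at hi
      obtain ⟨j, hj, rfl⟩ := hi
      have h1 := hr.pos j hj
      have h2 := hσ.chr_le _ (hi'.elim (hH₁ _) (hK _))
      omega
  · intro i hi
    rw [idSet_add, idSet_add] at hi
    rcases hi with (hi | hi) | hi
    · obtain ⟨j, hj, rfl⟩ := mem_idSet_shiftI.1 hi
      have := hr.pos j hj
      omega
    · exact hσ.pos i (hH₁ i hi)
    · exact hσ.pos i (hK i hi)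
  · intro i hi
    rw [idSet_add, idSet_add] at hi
    rcases hi with (hi | hi) | hi
    · obtain ⟨j, hj, rfl⟩ := mem_idSet_shiftI.1 hi
      have := le_maxId hr.tokens_sub hj
      show _ ≤ σ.cnt + _
      omega
    · exact (hσ.chr_le i (hH₁ i hi)).trans (Nat.le_add_right _ _)
    · exact (hσ.chr_le i (hK i hi)).trans (Nat.le_add_right _ _)
  · rintro i ⟨t, ht, hi⟩
    rcases ht with (ht | ⟨_, rfl⟩) | ⟨t, ht, rfl⟩
    · exact (hσ.tokens_le i ⟨t, ht, hi⟩).trans (Nat.le_add_right _ _)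
    · rw [ids_append, List.mem_append] at hi
      refine (hσ.chr_le i (hi.elim (fun hi => hH₁ i ?_) fun hi => hH₂ i ?_)).trans
        (Nat.le_add_right _ _) <;> rw [idSet_coe] <;> exact hi
    · obtain ⟨j, hj, rfl⟩ := List.mem_map.1 hi
      have := le_maxId hr.tokens_sub (hr.tokens_sub ⟨t, ht, hj⟩)
      show _ ≤ σ.cnt + _
      omega

theorem Solve.wf {CT : L.Theory} {σ τ : State L Pr N} (h : Solve CT σ τ) (hσ : σ.WF) : τ.WF := by
  obtain ⟨K, B, c, C, C', T, n, hC', h⟩ := h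
  exact ⟨fun d hd => hσ.bi_builtin d (Multiset.mem_cons_of_mem hd), hC', hσ.nodup, hσ.pos,
    hσ.chr_le, hσ.tokens_le⟩

theorem Apply.wf {CT : L.Theory} {P : Set (Rule L Pr N)} {V : Set ℕ} {σ τ : State L Pr N}
    (hP : ∀ r ∈ P, r.WF) (h : Apply CT P V σ τ) (hσ : σ.WF) : τ.WF := by
  obtain ⟨r, hr, ρ, h⟩ := apply_iff.1 h
  exact h.wf ((hP r hr).rename ρ) hσ

theorem Step.wf {CT : L.Theory} {P : Set (Rule L Pr N)} {V : Set ℕ} {σ τ : State L Pr N}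
    (hP : ∀ r ∈ P, r.WF) (h : Step CT P V σ τ) (hσ : σ.WF) : τ.WF :=
  h.elim (fun h => h.wf hσ) fun h => h.wf hP hσ

theorem NormalStep.step {CT : L.Theory} {P : Set (Rule L Pr N)} {V : Set ℕ} {σ τ : State L Pr N}
    (h : NormalStep CT P V σ τ) : Step CT P V σ τ :=
  h.imp id fun h => h.2

theorem NormalDerives.derives {CT : L.Theory} {P : Set (Rule L Pr N)} {V : Set ℕ}
    {σ τ : State L Pr N} (h : NormalDerives CT P V σ τ) : Derives CT P V σ τ :=
  Relation.ReflTransGen.mono (fun _ _ h => h.step) _ _ h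

theorem Derives.wf {CT : L.Theory} {P : Set (Rule L Pr N)} {V : Set ℕ} {σ τ : State L Pr N}
    (hP : ∀ r ∈ P, r.WF) (h : Derives CT P V σ τ) (hσ : σ.WF) : τ.WF := by
  induction h with
  | refl => exact hσ
  | tail _ h ih => exact h.wf hP ih

/-- Both transitions only strengthen the store. -/
theorem Step.failed {CT : L.Theory} {P : Set (Rule L Pr N)} {V : Set ℕ} {σ τ : State L Pr N}
    (h : Step CT P V σ τ) (hσ : σ.Failed CT) : τ.Failed CT := by
  rw [State.Failed, inconsistent_iff] at *
  rcases h with h | h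
  · obtain ⟨K, B, c, C, C', T, n, hC', h⟩ := h
    intro M val hval
    exact hσ M val (Formula.realize_inf.1 ((iff_realize.1 h M val).2 hval)).2
  · obtain ⟨r, _, ρ, H₁, H₂, K, _, _, _, _, _, _, rfl⟩ := apply_iff.1 h
    intro M val hval
    exact hσ M val (Formula.realize_inf.1 hval).2

theorem Derives.failed {CT : L.Theory} {P : Set (Rule L Pr N)} {V : Set ℕ} {σ τ : State L Pr N}
    (h : Derives CT P V σ τ) (hσ : σ.Failed CT) : τ.Failed CT := by
  induction h with
  | refl => exact hσ
  | tail _ h ih => exact h.failed ih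

/-- All built-in constraints of a configuration can be solved, without introducing variables. -/
theorem exists_solve_all (CT : L.Theory) (B : Multiset (L.Formula ℕ)) :
    ∀ (K : Multiset (IdAtom L Pr)) (C : L.Formula ℕ) (T : Set (Token N)) (n : ℕ),
      (∀ c ∈ B, IsBuiltin c) → IsBuiltin C →
      ∃ C', Relation.ReflTransGen (Solve CT) (⟨K, B, C, T, n⟩ : State L Pr N) ⟨K, 0, C', T, n⟩ ∧
        IsBuiltin C' ∧ fvF {C'} ⊆ fvF B ∪ fvF {C} ∧
        ∀ (M : Model CT) (val : ℕ → M), C'.Realize val ↔ C.Realize val ∧ Holds B val := by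
  induction B using Multiset.induction_on with
  | empty =>
    intro K C T n _ hC
    exact ⟨C, .refl, hC, Set.subset_union_right, fun M val => by simp [holds_zero]⟩
  | cons c B ih =>
    intro K C T n hB hC
    obtain ⟨C', h1, h2, h3, h4⟩ := ih K (c ⊓ C) T n
      (fun d hd => hB d (Multiset.mem_cons_of_mem hd)) (.and (hB c (Multiset.mem_cons_self _ _)) hC)
    -- The new store is the conjunction itself, not just an equivalent formula; this is what bounds
    -- its free variables.
    refine ⟨C', .head (.intro K B c C (c ⊓ C) T n (.and (hB c (Multiset.mem_cons_self _ _)) hC)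
      (Theory.Iff.refl _)) h1, h2, fun x hx => ?_, fun M val => ?_⟩
    · rcases h3 hx with ⟨d, hd, hx⟩ | ⟨d, hd, hx⟩
      · exact .inl ⟨d, Multiset.mem_cons_of_mem hd, hx⟩
      · obtain rfl := Multiset.mem_singleton.1 hd
        rcases (mem_freeVarFinset_inf _ _ _).1 hx with hx | hx
        · exact .inl ⟨c, Multiset.mem_cons_self _ _, hx⟩
        · exact .inr ⟨C, by simp, hx⟩
    · rw [h4, Formula.realize_inf, holds_cons]
      tauto

theorem NormalDerives.of_solve {CT : L.Theory} {σ τ : State L Pr N}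
    (h : Relation.ReflTransGen (Solve CT) σ τ) (P : Set (Rule L Pr N)) (V : Set ℕ) :
    NormalDerives CT P V σ τ :=
  Relation.ReflTransGen.mono (fun _ _ h => .inl h) _ _ h

theorem holds_rename {M : Type*} [L.Structure M] {Γ : Multiset (L.Formula ℕ)}
    {ρ : Equiv.Perm ℕ} {val : ℕ → M} :
    Holds (Γ.map (substF (renSubst ρ))) val ↔ Holds Γ (val ∘ ρ) :=
  holds_map

theorem list_map_injOn {α β : Type*} {f : α → β} {s : Set α} (hf : Set.InjOn f s) :
    ∀ {l l' : List α}, (∀ i ∈ l, i ∈ s) → (∀ i ∈ l', i ∈ s) → l.map f = l'.map f → l = l'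
  | [], [], _, _, _ => rfl
  | [], b :: l', _, _, h => by simp at h
  | a :: l, [], _, _, h => by simp at h
  | a :: l, b :: l', hl, hl', h => by
    simp only [List.map_cons, List.cons.injEq] at h
    rw [hf (hl a (by simp)) (hl' b (by simp)) h.1,
      list_map_injOn hf (fun i hi => hl i (by simp [hi])) (fun i hi => hl' i (by simp [hi])) h.2]

/-! ### Configurations that differ by identifiers and unsolved constraints -/

/-- The configurations agree up to a change of the identifiers, moving constraints between the two
parts of the store, and tokens with absent identifiers. -/
def Sim (CT : L.Theory) (σ τ : State L Pr N) : Prop :=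
  ∃ π : ℕ → ℕ, τ.chr = σ.chr.map (fun a => (a.1, π a.2)) ∧
    (∀ (M : Model CT) (val : ℕ → M),
      (τ.store.Realize val ∧ Holds τ.bi val) ↔ (σ.store.Realize val ∧ Holds σ.bi val)) ∧
    ∀ (a : N) (l : List ℕ), (∀ i ∈ l, i ∈ idSet σ.chr) →
      ((a, l) ∈ σ.tokens ↔ (a, l.map π) ∈ τ.tokens)

theorem Sim.of_id {CT : L.Theory} {σ τ : State L Pr N} (h1 : τ.chr = σ.chr)
    (h2 : ∀ (M : Model CT) (val : ℕ → M),
      (τ.store.Realize val ∧ Holds τ.bi val) ↔ (σ.store.Realize val ∧ Holds σ.bi val))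
    (h3 : ∀ (a : N) (l : List ℕ), (∀ i ∈ l, i ∈ idSet σ.chr) →
      ((a, l) ∈ σ.tokens ↔ (a, l) ∈ τ.tokens)) : Sim CT σ τ :=
  ⟨id, by simp [h1], h2, fun a l hl => by simpa using h3 a l hl⟩

theorem Sim.trans {CT : L.Theory} {σ τ υ : State L Pr N} (h : Sim CT σ τ) (h' : Sim CT τ υ) :
    Sim CT σ υ := by
  obtain ⟨π, h1, h2, h3⟩ := h
  obtain ⟨π', h1', h2', h3'⟩ := h'
  refine ⟨π' ∘ π, by simp [h1, h1'], fun M val => (h2' M val).trans (h2 M val), fun a l hl => ?_⟩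
  rw [h3 a l hl, h3' a, List.map_map]
  intro i hi
  obtain ⟨j, hj, rfl⟩ := List.mem_map.1 hi
  obtain ⟨b, hb, rfl⟩ := hl j hj
  rw [h1]
  exact ⟨_, Multiset.mem_map_of_mem _ hb, rfl⟩

/-- The images are the identifiers of `τ`, which are pairwise different. -/
theorem Sim.injOn {σ τ : State L Pr N} (hτ : τ.WF) {π : ℕ → ℕ}
    (h : τ.chr = σ.chr.map (fun a => (a.1, π a.2))) : Set.InjOn π (idSet σ.chr) := by
  have hnd := hτ.nodup
  rw [h, Multiset.map_map] at hnd
  rintro _ ⟨a, ha, rfl⟩ _ ⟨b, hb, rfl⟩ hab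
  rw [Multiset.inj_on_of_nodup_map hnd a ha b hb hab]

/-- The translation is inverted on the identifiers present in `σ`. Its values elsewhere are
irrelevant, since tokens are compared only when all their identifiers are present. -/
theorem Sim.symm {CT : L.Theory} {σ τ : State L Pr N} (h : Sim CT σ τ) (hτ : τ.WF) :
    Sim CT τ σ := by
  obtain ⟨π, h1, h2, h3⟩ := h
  have hinj := Sim.injOn hτ h1
  have hinv : ∀ i ∈ idSet σ.chr, Function.invFunOn π (idSet σ.chr) (π i) = i := fun i hi =>
    hinj.leftInvOn_invFunOn hi
  have hids : ∀ i ∈ idSet τ.chr, ∃ j ∈ idSet σ.chr, π j = i := by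
    rintro _ ⟨a, ha, rfl⟩
    rw [h1] at ha
    obtain ⟨b, hb, rfl⟩ := Multiset.mem_map.1 ha
    exact ⟨b.2, ⟨b, hb, rfl⟩, rfl⟩
  refine ⟨Function.invFunOn π (idSet σ.chr), ?_, fun M val => (h2 M val).symm, fun a l hl => ?_⟩
  · rw [h1, Multiset.map_map]
    conv_lhs => rw [← Multiset.map_id σ.chr]
    exact Multiset.map_congr rfl fun a ha => by simp [hinv a.2 ⟨a, ha, rfl⟩]
  · rw [h3, List.map_map]
    · have : l.map (π ∘ Function.invFunOn π (idSet σ.chr)) = l := by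
        conv_rhs => rw [← List.map_id l]
        refine List.map_congr_left fun i hi => ?_
        obtain ⟨j, hj, rfl⟩ := hids i (hl i hi)
        simp [hinv j hj]
      rw [this]
    · intro i hi
      obtain ⟨k, hk, rfl⟩ := List.mem_map.1 hi
      obtain ⟨j, hj, rfl⟩ := hids k (hl k hk)
      rwa [hinv j hj]

theorem Sim.rename {CT : L.Theory} {σ τ : State L Pr N} (h : Sim CT σ τ) (κ : Equiv.Perm ℕ) :
    Sim CT (σ.rename κ) (τ.rename κ) := by
  obtain ⟨π, h1, h2, h3⟩ := h
  refine ⟨π, by simp [State.rename, h1, renameI, Function.comp_def], fun M val => ?_, fun a l hl => h3 a l ?_⟩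
  · simpa only [State.rename, realize_rename, holds_rename] using h2 M (val ∘ κ)
  · simpa only [State.rename, idSet_rename] using hl

/-- Applying the same rule to related configurations. -/
theorem Sim.applyWith {CT : L.Theory} {σ σ' τ : State L Pr N} {r : Rule L Pr N} {V : Set ℕ}
    (h : Sim CT σ τ) (hσ : σ.WF) (hτ : τ.WF) (hr : r.WF) (hbi : τ.bi = 0)
    (happ : ApplyWith CT r V σ σ') (hfr : Disjoint r.fv (V ∪ τ.fv)) :
    ∃ τ', ApplyWith CT r V τ τ' ∧ Sim CT σ' τ' := by
  obtain ⟨π, h1, h2, h3⟩ := h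
  obtain ⟨H₁, H₂, K, hchr, hfresh, hkeep, hremove, hent, htoken, rfl⟩ := happ
  have hinj := Sim.injOn hτ h1
  let f : IdAtom L Pr → IdAtom L Pr := fun a => (a.1, π a.2)
  have hc : ∀ H : List (IdAtom L Pr), chr (H.map f) = chr H := fun H => by simp [chr, f]
  have hi : ∀ H : List (IdAtom L Pr), ids (H.map f) = (ids H).map π := fun H => by
    simp [ids, f]
  have hcc : chr (H₁.map f ++ H₂.map f) = chr (H₁ ++ H₂) := by rw [← List.map_append, hc]
  have hii : ids (H₁.map f ++ H₂.map f) = (ids (H₁ ++ H₂)).map π := by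
    rw [← List.map_append, hi]
  have hmem : ∀ i ∈ ids (H₁ ++ H₂), i ∈ idSet σ.chr := fun i hi => by
    rw [hchr, Multiset.coe_add, idSet_add, idSet_coe]; exact .inl hi
  have hπle : ∀ i ∈ idSet σ.chr, π i ≤ τ.cnt := by
    rintro _ ⟨a, ha, rfl⟩
    refine hτ.chr_le _ ?_
    rw [h1]
    exact ⟨_, Multiset.mem_map_of_mem _ ha, rfl⟩
  refine ⟨_, ⟨H₁.map f, H₂.map f, K.map f, ?_, hfr, ?_, ?_, ?_, ?_, rfl⟩, ?_⟩
  · rw [h1, hchr]; simp [f]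
  · rwa [hc]
  · rwa [hc]
  · rw [hcc]
    intro M val hval
    -- Nothing is unsolved in `τ`, so its store entails that of `σ`, and with it whatever `σ`
    -- entails.
    exact hent M val ((h2 M val).1 ⟨hval, by rw [hbi]; exact holds_zero⟩).1
  · rw [hii, ← h3 _ _ hmem]; exact htoken
  · let π' : ℕ → ℕ := fun i => if i ≤ σ.cnt then π i else i - σ.cnt + τ.cnt
    have hold : ∀ i ∈ idSet σ.chr, π' i = π i := fun i hi => if_pos (hσ.chr_le i hi)
    have hnew : ∀ i ∈ idSet r.chr, π' (i + σ.cnt) = i + τ.cnt := fun i hi => by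
      have := hr.pos i hi
      simp only [π']
      rw [if_neg (by omega)]
      omega
    have hsplit : ∀ i, i ∈ idSet (shiftI σ.cnt r.chr + (↑H₁ : Multiset _) + K) → i ∈ idSet σ.chr ∨
        ∃ j ∈ idSet r.chr, i = j + σ.cnt := by
      intro i hi
      rw [idSet_add, idSet_add] at hi
      rcases hi with (hi | hi) | hi
      · obtain ⟨j, hj, rfl⟩ := mem_idSet_shiftI.1 hi
        exact .inr ⟨j, hj, rfl⟩
      · left; rw [hchr, idSet_add, idSet_add]; exact .inl (.inl hi)
      · left; rw [hchr, idSet_add, idSet_add]; exact .inr hi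
    -- A list whose translated identifiers stay below the counter of `τ` mentions no constraint of
    -- the new body.
    have hback : ∀ l : List ℕ, (∀ i ∈ l, i ∈ idSet (shiftI σ.cnt r.chr + (↑H₁ : Multiset _) + K)) →
        (∀ i ∈ l.map π', i ≤ τ.cnt) → ∀ i ∈ l, i ∈ idSet σ.chr := by
      intro l hl hle i hi
      rcases hsplit i (hl i hi) with h | ⟨j, hj, rfl⟩
      · exact h
      · have h1 := hle _ (List.mem_map_of_mem hi)
        rw [hnew j hj] at h1
        have := hr.pos j hj
        omega
    refine ⟨π', ?_, fun M val => ?_, fun a l hl => ?_⟩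
    · simp only [Multiset.map_add]
      congr 1
      · congr 1
        · simp only [shiftI, Multiset.map_map]
          refine Multiset.map_congr rfl fun a ha => ?_
          simp [hnew a.2 ⟨a, ha, rfl⟩]
        · rw [Multiset.map_coe, Multiset.coe_eq_coe]
          refine .of_eq (List.map_congr_left fun a ha => ?_)
          simp only [f]
          rw [hold]
          rw [hchr, idSet_add, idSet_add]
          exact .inl (.inl ⟨a, ha, rfl⟩)
      · refine Multiset.map_congr rfl fun a ha => ?_
        simp only [f]
        rw [hold]
        rw [hchr, idSet_add, idSet_add]
        exact .inr ⟨a, ha, rfl⟩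
    · have := h2 M val
      rw [hcc, Formula.realize_inf, Formula.realize_inf, holds_add, holds_add]
      tauto
    · simp only [Set.mem_union, Set.mem_ofPred_eq, hii, List.map_eq_nil_iff, Prod.mk.injEq]
      -- Earlier tokens and the propagation token mention old identifiers only, tokens of the rule
      -- new ones only, so the two groups are compared separately.
      refine or_congr ?_ ?_
      · constructor
        · rintro (h | ⟨h, rfl, rfl⟩)
          · have hl' : ∀ i ∈ l, i ∈ idSet σ.chr := fun i hi => by
              rcases hsplit i (hl i hi) with h' | ⟨j, hj, rfl⟩
              · exact h'
              · have h1 := hσ.tokens_le _ ⟨_, h, hi⟩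
                have := hr.pos j hj
                omega
            rw [List.map_congr_left fun i hi => hold i (hl' i hi)]
            exact .inl ((h3 a l hl').1 h)
          · exact .inr ⟨h, rfl, List.map_congr_left fun i hi => hold i (hmem i hi)⟩
        · rintro (h | ⟨h, rfl, h'⟩)
          · have hl' := hback l hl fun i hi => hτ.tokens_le _ ⟨_, h, hi⟩
            rw [List.map_congr_left fun i hi => hold i (hl' i hi)] at h
            exact .inl ((h3 a l hl').2 h)
          · have hl' := hback l hl fun i hi => by
              rw [h'] at hi
              obtain ⟨j, hj, rfl⟩ := List.mem_map.1 hi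
              exact hπle j (hmem j hj)
            rw [List.map_congr_left fun i hi => hold i (hl' i hi)] at h'
            exact .inr ⟨h, rfl, list_map_injOn hinj hl' hmem h'⟩
      · constructor
        · rintro ⟨⟨b, l₀⟩, h, h'⟩
          simp only [Prod.mk.injEq] at h'
          obtain ⟨rfl, rfl⟩ := h'
          refine ⟨(b, l₀), h, ?_⟩
          simp only [List.map_map, Prod.mk.injEq, true_and]
          exact List.map_congr_left fun i hi => (hnew i (hr.tokens_sub ⟨_, h, hi⟩)).symm
        · rintro ⟨⟨b, l₀⟩, h, h'⟩
          simp only [Prod.mk.injEq] at h'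
          obtain ⟨rfl, h'⟩ := h'
          refine ⟨(b, l₀), h, ?_⟩
          simp only [Prod.mk.injEq, true_and]
          have hnew' : ∀ i ∈ l, ∃ j ∈ idSet r.chr, i = j + σ.cnt := by
            intro i hi
            refine (hsplit i (hl i hi)).resolve_left fun hi' => ?_
            have h4 := List.mem_map_of_mem (f := π') hi
            rw [← h', hold i hi'] at h4
            obtain ⟨j, hj, hj'⟩ := List.mem_map.1 h4
            have := hr.pos j (hr.tokens_sub ⟨_, h, hj⟩)
            have := hπle i hi'
            omega
          have hl : l.map π' = (l.map (· - σ.cnt)).map (· + τ.cnt) := by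
            rw [List.map_map]
            refine List.map_congr_left fun i hi => ?_
            obtain ⟨j, hj, rfl⟩ := hnew' i hi
            simp [hnew j hj]
          rw [hl] at h'
          have h'' := (List.map_injective_iff.2 (add_left_injective τ.cnt)) h'
          rw [h'', List.map_map]
          conv_rhs => rw [← List.map_id l]
          refine List.map_congr_left fun i hi => ?_
          obtain ⟨j, hj, rfl⟩ := hnew' i hi
          simp

end Invariants

/-! ### Unfolding -/

section Unfolding

variable {L : FirstOrder.Language.{u, v}} {Pr : Type w} {N : Type w'}

/-- Injectivity of the function symbols peels off the term down to its variables. -/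
theorem ClarkEquality.realize_inj {CT : L.Theory} (hCT : ClarkEquality CT) (M : Model CT)
    (t : L.Term ℕ) {f g : ℕ → M} (h : t.realize f = t.realize g) :
    ∀ x ∈ t.varFinset, f x = g x := by
  induction t with
  | var a => simpa using h
  | func F ts ih =>
    intro x hx
    simp only [Term.varFinset, Finset.mem_biUnion, Finset.mem_univ, true_and] at hx
    obtain ⟨i, hx⟩ := hx
    exact ih i (congrFun (hCT.injective M F h) i) x hx

theorem exists_mem_zip_of_forall₂ {α β : Type*} {R : α → β → Prop} {l : List α} {l' : List β}
    (h : List.Forall₂ R l l') {b : β} (hb : b ∈ l') : ∃ a, (a, b) ∈ l.zip l' ∧ R a b := by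
  induction h with
  | nil => simp at hb
  | cons h _ ih =>
    rcases List.mem_cons.1 hb with rfl | hb
    · exact ⟨_, by simp, h⟩
    · obtain ⟨a, ha, hr⟩ := ih hb
      exact ⟨a, by simp [ha], hr⟩

theorem exists_mem_zip_of_length_eq {α β : Type*} {l : List α} {l' : List β}
    (h : l.length = l'.length) {b : β} (hb : b ∈ l') : ∃ a, (a, b) ∈ l.zip l' := by
  have : List.Forall₂ (fun _ _ => True) l l' := by
    rw [List.forall₂_iff_zip]; simp [h]
  obtain ⟨a, ha, _⟩ := exists_mem_zip_of_forall₂ this hb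
  exact ⟨a, ha⟩

theorem comparable_append {H₁ H₂ H₁' H₂' : List (Atom L Pr)} (h₁ : Comparable H₁ H₁')
    (h₂ : Comparable H₂ H₂') : Comparable (H₁ ++ H₂) (H₁' ++ H₂') :=
  List.rel_append h₁ h₂

theorem comparable_nil_iff {H H' : List (Atom L Pr)} (h : Comparable H H') : H = [] ↔ H' = [] := by
  rw [← List.length_eq_zero_iff, ← List.length_eq_zero_iff, h.length_eq]

/-- Matching equations determine the values of the variables of the head. -/
theorem ClarkEquality.eqs_unique {CT : L.Theory} (hCT : ClarkEquality CT) (M : Model CT)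
    {H H' : List (Atom L Pr)} (hc : Comparable H H') (hd : Disjoint (fvA H') (fvA H))
    {f g : ℕ → M} (hfg : ∀ y, y ∉ fvA H' → f y = g y)
    (hf : Holds (↑(eqs H H') : Multiset (L.Formula ℕ)) f)
    (hg : Holds (↑(eqs H H') : Multiset (L.Formula ℕ)) g) : f = g := by
  funext x
  by_cases hx : x ∈ fvA H'
  · obtain ⟨b, hb, t, ht, hxt⟩ := hx
    obtain ⟨a, hab, _, hlen⟩ := exists_mem_zip_of_forall₂ hc hb
    obtain ⟨s, hst⟩ := exists_mem_zip_of_length_eq hlen ht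
    have he : s.equal t ∈ (↑(eqs H H') : Multiset (L.Formula ℕ)) :=
      Multiset.mem_coe.2 (mem_eqs.2 ⟨(a, b), hab, (s, t), hst, rfl⟩)
    have h1 := Formula.realize_equal.1 (hf _ he)
    have h2 := Formula.realize_equal.1 (hg _ he)
    -- The left-hand term `s` avoids the variables of `H'`, so `f` and `g` give it the same value;
    -- hence they agree on `t`, and by injectivity on its variables.
    refine hCT.realize_inj M t ?_ x hxt
    rw [← h1, ← h2]
    refine term_realize_congr s fun y hy => hfg y fun hy' => ?_
    exact Set.disjoint_left.1 hd hy' ⟨a, (List.of_mem_zip hab).1, s, (List.of_mem_zip hst).1, hy⟩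
  · exact hfg x hx

/-- The filter defining D'' enters only through two facts: its members are guard constraints of `v`,
and each guard constraint of `v` is entailed or kept. -/
theorem IsUnfolding.exists_eq {CT : L.Theory} {r v r' : Rule L Pr N} (h : IsUnfolding CT r v r') :
    ∃ (K : Multiset (IdAtom L Pr)) (S₁ S₂ : List (IdAtom L Pr)) (θ : ℕ → L.Term ℕ)
      (D'' : Multiset (L.Formula ℕ)),
      r.chr = K + ↑S₁ + ↑S₂ ∧ Comparable (chr S₁) v.keep ∧ Comparable (chr S₂) v.remove ∧
      (∀ x, x ∉ fvA v.head → θ x = Term.var x) ∧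
      (∀ e ∈ eqs (chr (S₁ ++ S₂)) (v.head.map (Atom.subst θ)), Entails CT (r.bi + r.guard) e) ∧
      (v.name, ids (S₁ ++ S₂)) ∉ r.tokens ∧
      (∀ c ∈ D'', c ∈ v.guard) ∧
      (∀ c ∈ v.guard, Entails CT (r.bi + r.guard) (substF θ c) ∨ c ∈ D'') ∧
      r' = ⟨r.name, r.keep, r.remove, r.guard + D''.map (substF θ),
        K + ↑S₁ + shiftI (maxId r.chr r.tokens) v.chr,
        r.bi + v.bi + ↑(eqs (chr (S₁ ++ S₂)) v.head),
        clean (K + (↑S₁ : Multiset (IdAtom L Pr))) r.tokens ∪ shiftT (maxId r.chr r.tokens) v.tokens ∪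
          {t | v.remove = [] ∧ t = (v.name, ids S₁)}⟩ := by
  classical
  obtain ⟨K, S₁, S₂, θ, D'', B₁, T₁, m₁, h1, h2, h3, h4, h5, h6, h7, h8, h9, rfl⟩ := h
  simp only [inst, Prod.mk.injEq] at h9
  obtain ⟨rfl, rfl, rfl⟩ := h9
  refine ⟨K, S₁, S₂, θ, D'', h1, h2, h3, h4, h5, h6, fun c hc => ?_, fun c hc => ?_, ?_⟩
  · rw [h7] at hc
    exact (Multiset.mem_filter.1 hc).1
  · by_cases h : Entails CT (r.bi + r.guard) (substF θ c)
    · exact .inl h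
    · right
      rw [h7]
      exact Multiset.mem_filter.2 ⟨hc, h⟩
  · congr 1
    ext t
    split_ifs with h <;> simp [h]

/-- The identifiers of `v` are positive and shifted by the greatest identifier of `r`, so they do
not clash with those kept from `r`. -/
theorem IsUnfolding.wf {CT : L.Theory} {r v r' : Rule L Pr N} (h : IsUnfolding CT r v r')
    (hr : r.WF) (hv : v.WF) : r'.WF := by
  obtain ⟨K, S₁, S₂, θ, D'', hchr, hk, hrm, hθ, hent, htok, hD, hD', rfl⟩ := h.exists_eq
  have hsub : ∀ i ∈ idSet (K + (↑S₁ : Multiset _)), i ∈ idSet r.chr := fun i hi => by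
    rw [hchr, idSet_add]; exact .inl hi
  have hnd := hr.nodup
  rw [hchr, Multiset.map_add] at hnd
  constructor
  · exact hr.head_ne
  · intro c hc
    rcases Multiset.mem_add.1 hc with hc | hc
    · exact hr.guard_builtin c hc
    · obtain ⟨d, hd, rfl⟩ := Multiset.mem_map.1 hc
      exact (hv.guard_builtin d (hD d hd)).subst θ
  · intro c hc
    rcases Multiset.mem_add.1 hc with hc | hc
    · rcases Multiset.mem_add.1 hc with hc | hc
      exacts [hr.bi_builtin c hc, hv.bi_builtin c hc]
    · exact eqs_builtin (Multiset.mem_coe.1 hc)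
  · simp only [Multiset.map_add (Prod.snd) (K + _)]
    rw [Multiset.nodup_add]
    refine ⟨(Multiset.nodup_add.1 hnd).1, ?_, ?_⟩
    · have : (shiftI (maxId r.chr r.tokens) v.chr).map Prod.snd =
          (v.chr.map Prod.snd).map (· + maxId r.chr r.tokens) := by
        simp [shiftI]
      rw [this]
      exact hv.nodup.map (add_left_injective _)
    · rw [Multiset.disjoint_left]
      intro i hi hi'
      rw [← mem_idSet] at hi hi'
      obtain ⟨j, hj, rfl⟩ := mem_idSet_shiftI.1 hi'
      have := le_maxId hr.tokens_sub (hsub _ hi)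
      have := hv.pos j hj
      omega
  · intro i hi
    rw [idSet_add] at hi
    rcases hi with hi | hi
    · exact hr.pos i (hsub i hi)
    · obtain ⟨j, hj, rfl⟩ := mem_idSet_shiftI.1 hi
      have := hv.pos j hj
      omega
  · rintro i ⟨t, ht, hi⟩
    rw [idSet_add]
    rcases ht with (ht | ⟨t, ht, rfl⟩) | ⟨_, rfl⟩
    · exact .inl (ht.2 i hi)
    · obtain ⟨j, hj, rfl⟩ := List.mem_map.1 hi
      exact .inr (mem_idSet_shiftI.2 ⟨j, hv.tokens_sub ⟨t, ht, hj⟩, rfl⟩)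
    · rw [idSet_add, idSet_coe]
      exact .inl (.inr hi)

set_option maxHeartbeats 600000 in
/-- An application of an unfolded rule amounts to applications of the two rules. -/
theorem IsUnfolding.applyWith {CT : L.Theory} (hCT : ClarkEquality CT) {P : Set (Rule L Pr N)}
    {V : Set ℕ} {r v r' : Rule L Pr N} {σ τ' : State L Pr N} (h : IsUnfolding CT r v r')
    (hrP : ∃ r₀ ∈ P, ∃ ρ : Equiv.Perm ℕ, r = r₀.rename ρ)
    (hvP : ∃ v₀ ∈ P, ∃ ρ : Equiv.Perm ℕ, v = v₀.rename ρ)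
    (hr : r.WF) (hv : v.WF) (hvr : Disjoint v.fv r.fv) (hσ : σ.WF) (hbi : σ.bi = 0)
    (hrσ : Disjoint r.fv (V ∪ σ.fv)) (hvσ : Disjoint v.fv (V ∪ σ.fv))
    (happ : ApplyWith CT r' V σ τ') :
    ∃ τ, Relation.TransGen (NormalStep CT P V) σ τ ∧ τ.bi = 0 ∧ Sim CT τ' τ := by
  have hr' := h.wf hr hv
  obtain ⟨Kr, S₁, S₂, θ, D'', hchr, hk, hrm, hθ, hent, htok, hD, hD', rfl⟩ :=
    h.exists_eq
  obtain ⟨H₁, H₂, K, hσchr, _, hkeep, hremove, hent', htoken, rfl⟩ := happ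
  obtain ⟨S, B, C, T, n⟩ := σ
  obtain rfl : B = 0 := hbi
  obtain rfl : S = _ := hσchr
  change EntailsExists CT C (fvA r.head) (↑(eqs (chr (H₁ ++ H₂)) r.head) +
    (r.guard + D''.map (substF θ))) at hent'
  change (r.name, ids (H₁ ++ H₂)) ∉ T at htoken
  have hHn : ∀ i ∈ ids (H₁ ++ H₂), i ≤ n := fun i hi =>
    hσ.chr_le i (by rw [Multiset.coe_add, idSet_add, idSet_coe]; exact .inl hi)
  have hSids : ∀ i ∈ ids (S₁ ++ S₂), i ∈ idSet r.chr := fun i hi => by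
    rw [hchr, add_assoc, Multiset.coe_add, idSet_add, idSet_coe]; exact .inr hi
  have hSfv : fvA (chr (S₁ ++ S₂)) ⊆ r.fv := fun x hx => by
    refine .inl (.inr ?_)
    rw [hchr, add_assoc, Multiset.coe_add, fvI_add, fvI_coe]; exact .inr hx
  have hHfv : fvA (chr (H₁ ++ H₂)) ⊆
      (⟨↑H₁ + ↑H₂ + K, 0, C, T, n⟩ : State L Pr N).fv := fun x hx => by
    refine .inl (.inl ?_)
    rw [Multiset.coe_add, fvI_add, fvI_coe]; exact .inl hx
  have hhead : fvA r.head ⊆ r.fv := fun x hx => .inl (.inl (.inl hx))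
  have hvhead : fvA v.head ⊆ v.fv := fun x hx => .inl (.inl (.inl hx))
  have hcompH : Comparable (chr (H₁ ++ H₂)) r.head := by
    rw [chr_append]; exact comparable_append hkeep hremove
  have hcompS : Comparable (chr (S₁ ++ S₂)) v.head := by
    rw [chr_append]; exact comparable_append hk hrm
  -- the application of `r`
  let σa : State L Pr N := ⟨shiftI n r.chr + ↑H₁ + K, r.bi + 0,
    conj (eqs (chr (H₁ ++ H₂)) r.head) ⊓ C,
    T ∪ {t | H₂ = [] ∧ t = (r.name, ids (H₁ ++ H₂))} ∪ shiftT n r.tokens,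
    n + maxId r.chr r.tokens⟩
  have hstepa : ApplyWith CT r V ⟨↑H₁ + ↑H₂ + K, 0, C, T, n⟩ σa := by
    refine ⟨H₁, H₂, K, rfl, hrσ, hkeep, hremove, fun M val hval => ?_, htoken, rfl⟩
    obtain ⟨val', h1, h2⟩ := hent' M val hval
    rw [holds_add, holds_add] at h2
    exact ⟨val', h1, holds_add.2 ⟨h2.1, h2.2.1⟩⟩
  have hwfa : σa.WF := hstepa.wf hr hσ
  -- Solving here keeps the derivation normal and puts the body constraints of `r`, on which the
  -- unfolding conditions rely, into the store. No new variables appear, so `v` remains apart.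
  obtain ⟨Cb, hsolve, hCb, hCbfv, hCbr⟩ := exists_solve_all CT σa.bi σa.chr σa.store σa.tokens
    σa.cnt hwfa.bi_builtin hwfa.store_builtin
  let σb : State L Pr N := ⟨σa.chr, 0, Cb, σa.tokens, σa.cnt⟩
  have hafv : σa.fv ⊆ r.fv ∪ (⟨↑H₁ + ↑H₂ + K, 0, C, T, n⟩ : State L Pr N).fv := by
    rintro x ((hx | hx) | ⟨c, hc, hx⟩)
    · simp only [σa, fvI_add, fvI_shiftI] at hx
      rcases hx with (hx | hx) | hx
      · exact .inl (.inl (.inr hx))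
      · refine .inr (.inl (.inl ?_)); rw [fvI_add, fvI_add]; exact .inl (.inl hx)
      · refine .inr (.inl (.inl ?_)); rw [fvI_add]; exact .inr hx
    · simp only [σa, add_zero] at hx
      exact .inl (.inr hx)
    · obtain rfl := Multiset.mem_singleton.1 hc
      rcases (mem_freeVarFinset_inf _ _ _).1 hx with hx | hx
      · obtain ⟨c, hc, hx⟩ := (mem_freeVarFinset_conj _ _).1 hx
        exact (fvF_eqs_subset _ _ ⟨c, Multiset.mem_coe.2 hc, hx⟩).symm.imp (@hhead x) (@hHfv x)
      · exact .inr (.inr ⟨C, by simp, hx⟩)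
  have hbfv : σb.fv ⊆ σa.fv := by
    rintro x ((hx | hx) | hx)
    · exact .inl (.inl hx)
    · simp [σb, fvF] at hx
    · exact (hCbfv hx).elim (fun hx => .inl (.inr hx)) fun hx => .inr hx
  -- what holds in the store after that
  have hstore : ∀ (M : Model CT) (val : ℕ → M), Cb.Realize val ↔
      (Holds (↑(eqs (chr (H₁ ++ H₂)) r.head) : Multiset (L.Formula ℕ)) val ∧ C.Realize val) ∧
        Holds r.bi val := by
    intro M val
    rw [hCbr]
    simp only [σa, add_zero, Formula.realize_inf, realize_conj]
    rfl
  have hguard : ∀ (M : Model CT) (val : ℕ → M), Cb.Realize val →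
      Holds r.guard val ∧ Holds D'' fun x => (θ x).realize val := by
    intro M val hval
    obtain ⟨⟨h1, h2⟩, h3⟩ := (hstore M val).1 hval
    obtain ⟨val', h4, h5⟩ := hent' M val h2
    rw [holds_add, holds_add, holds_map] at h5
    -- Both valuations satisfy the head equations and differ at most on the head variables of `r`,
    -- so they coincide.
    obtain rfl : val' = val := hCT.eqs_unique M hcompH
      (Set.disjoint_of_subset hhead (hHfv.trans Set.subset_union_right) hrσ) h4 h5.1 h1
    exact h5.2
  let f : IdAtom L Pr → IdAtom L Pr := fun a => (a.1, a.2 + n)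
  have hcf : ∀ H : List (IdAtom L Pr), chr (H.map f) = chr H := fun H => by simp [chr, f]
  have hif : ∀ H : List (IdAtom L Pr), ids (H.map f) = (ids H).map (· + n) := fun H => by
    simp [ids, f]
  -- The head of `v` is not empty, so its match contains an identifier. Being positive, this exceeds
  -- `n` after the shift, which tells the token of `v` from older ones.
  have hSne : ids (S₁ ++ S₂) ≠ [] := by
    intro h
    have : S₁ ++ S₂ = [] := by simpa [ids] using h
    rw [this] at hcompS
    exact hv.head_ne ((comparable_nil_iff hcompS).1 rfl)
  obtain ⟨i₀, hi₀⟩ := List.exists_mem_of_ne_nil _ hSne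
  have hi₀pos := hr.pos i₀ (hSids i₀ hi₀)
  -- the application of `v`
  let σc : State L Pr N := ⟨shiftI σb.cnt v.chr + ↑(S₁.map f) + (shiftI n Kr + ↑H₁ + K),
    v.bi + 0, conj (eqs (chr (S₁.map f ++ S₂.map f)) v.head) ⊓ Cb,
    σb.tokens ∪ {t | S₂.map f = [] ∧ t = (v.name, ids (S₁.map f ++ S₂.map f))} ∪
      shiftT σb.cnt v.tokens, σb.cnt + maxId v.chr v.tokens⟩
  have hstepc : ApplyWith CT v V σb σc := by
    refine ⟨S₁.map f, S₂.map f, shiftI n Kr + ↑H₁ + K, ?_, ?_, ?_, ?_, ?_, ?_, rfl⟩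
    · simp only [σb, σa, hchr, shiftI, Multiset.map_add, Multiset.map_coe, f]
      ac_rfl
    · rw [Set.disjoint_left]
      rintro x hx (hx' | hx')
      · exact Set.disjoint_left.1 hvσ hx (.inl hx')
      · rcases hafv (hbfv hx') with hx' | hx'
        · exact Set.disjoint_left.1 hvr hx hx'
        · exact Set.disjoint_left.1 hvσ hx (.inr hx')
    · rwa [hcf]
    · rwa [hcf]
    · rw [← List.map_append, hcf]
      intro M val hval
      obtain ⟨hg, hg'⟩ := hguard M val hval
      have hrr : Holds (r.bi + r.guard) val := holds_add.2 ⟨((hstore M val).1 hval).2, hg⟩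
      -- The head variables of `v` receive the values prescribed by `θ`. The constraints `S₁`, `S₂`
      -- are unaffected by `θ`, as their variables belong to `r`.
      refine ⟨fun x => (θ x).realize val, fun y hy => by simp [hθ y hy],
        holds_add.2 ⟨?_, fun c hc => ?_⟩⟩
      · rw [← holds_map, Multiset.map_coe, eqs_subst]
        have : (chr (S₁ ++ S₂)).map (Atom.subst θ) = chr (S₁ ++ S₂) := by
          conv_rhs => rw [← List.map_id (chr (S₁ ++ S₂))]
          refine List.map_congr_left fun a ha => ?_
          rw [a.subst_congr (g := renSubst 1), Atom.subst_one]; rfl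
          intro x hx
          refine hθ x fun hx' => ?_
          exact Set.disjoint_left.1 hvr (hvhead hx') (hSfv ⟨a, ha, hx⟩)
        rw [this]
        intro e he
        exact hent e (Multiset.mem_coe.1 he) M val hrr
      · rcases hD' c hc with h | h
        · exact (realize_substF _ _ _).1 (h M val hrr)
        · exact hg' c h
    · rw [← List.map_append, hif]
      -- Tokens in `T` and the token of `r` have identifiers at most `n`; a local token of `r` is
      -- excluded by the side condition of unfolding.
      rintro ((h | ⟨_, h⟩) | ⟨⟨b, l⟩, h, h'⟩)
      · have := hσ.tokens_le _ ⟨_, h, List.mem_map_of_mem hi₀⟩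
        simp only at this
        omega
      · simp only [Prod.mk.injEq] at h
        have := hHn (i₀ + n) (by rw [← h.2]; exact List.mem_map.2 ⟨i₀, hi₀, rfl⟩)
        omega
      · simp only [Prod.mk.injEq] at h'
        obtain ⟨rfl, h'⟩ := h'
        rw [List.map_injective_iff.2 (add_left_injective n) h'] at h
        exact htok h
  have hwfb : σb.WF := (NormalDerives.of_solve hsolve (∅ : Set (Rule L Pr N)) ∅).derives.wf
    (by simp) hwfa
  have hwfc : σc.WF := hstepc.wf hv hwfb
  obtain ⟨Cd, hsolve', hCd, _, hCdr⟩ := exists_solve_all CT σc.bi σc.chr σc.store σc.tokens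
    σc.cnt hwfc.bi_builtin hwfc.store_builtin
  have hna : NormalStep CT P V ⟨↑H₁ + ↑H₂ + K, 0, C, T, n⟩ σa := by
    obtain ⟨r₀, hr₀, ρ, rfl⟩ := hrP
    exact .inr ⟨.inr rfl, apply_iff.2 ⟨r₀, hr₀, ρ, hstepa⟩⟩
  have hnc : NormalStep CT P V σb σc := by
    obtain ⟨v₀, hv₀, ρ, rfl⟩ := hvP
    exact .inr ⟨.inr rfl, apply_iff.2 ⟨v₀, hv₀, ρ, hstepc⟩⟩
  -- No translation of identifiers is needed: the body of `v` is shifted by `n` plus the greatest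
  -- identifier of `r` either way. The counters may differ, but `Sim` ignores them.
  refine ⟨⟨σc.chr, 0, Cd, σc.tokens, σc.cnt⟩, ?_, rfl, .of_id ?_ ?_ ?_⟩
  · exact (((Relation.TransGen.single hna).trans_left (NormalDerives.of_solve hsolve P V)).tail
      hnc).trans_left (NormalDerives.of_solve hsolve' P V)
  · simp only [σc, σb, σa, shiftI, Multiset.map_add, Multiset.map_map, Multiset.map_coe, f,
      Function.comp_def]
    have : (v.chr.map fun a => (a.1, a.2 + maxId r.chr r.tokens + n)) =
        v.chr.map fun a => (a.1, a.2 + (n + maxId r.chr r.tokens)) :=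
      Multiset.map_congr rfl fun a _ => by rw [add_assoc, add_comm n]
    rw [this]
    ac_rfl
  · intro M val
    have h1 := hCdr M val
    have h2 := hstore M val
    simp only [σc, add_zero, Formula.realize_inf, realize_conj, ← List.map_append, hcf] at h1
    simp only [add_zero, Formula.realize_inf, realize_conj, holds_add, holds_zero, and_true, Rule.head]
    rw [h1, h2]
    simp only [Holds, Multiset.mem_coe, Rule.head]
    tauto
  · intro a l hl
    -- The identifiers present lie in three separate ranges: at most `n` for the old ones, then
    -- those kept from `r`, then those from `v`.
    have hl' : ∀ i ∈ l, (∃ j ∈ idSet (Kr + (↑S₁ : Multiset _)), i = j + n) ∨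
        (∃ j, maxId r.chr r.tokens < j ∧ i = j + n) ∨ i ≤ n := by
      intro i hi
      have := hl i hi
      simp only [idSet_add _ K, idSet_add _ (H₁ : Multiset (IdAtom L Pr))] at this
      rcases this with (h | h) | h
      · obtain ⟨j, hj, rfl⟩ := mem_idSet_shiftI.1 h
        rw [idSet_add] at hj
        rcases hj with hj | hj
        · exact .inl ⟨j, hj, rfl⟩
        · obtain ⟨k, hk, rfl⟩ := mem_idSet_shiftI.1 hj
          have := hv.pos k hk
          exact .inr (.inl ⟨_, by omega, rfl⟩)
      · exact .inr (.inr (hσ.chr_le i (by rw [idSet_add, idSet_add]; exact .inl (.inl h))))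
      · exact .inr (.inr (hσ.chr_le i (by rw [idSet_add, idSet_add]; exact .inr h)))
    -- A token of `r` dropped by cleaning mentions a constraint of `S₂`, which `v` has removed.
    have hA : (a, l) ∈ shiftT n (clean (Kr + (↑S₁ : Multiset (IdAtom L Pr))) r.tokens) ↔
        (a, l) ∈ shiftT n r.tokens := by
      refine ⟨fun ⟨t, ht, h⟩ => ⟨t, ht.1, h⟩, fun ⟨⟨b, l₀⟩, ht, h⟩ =>
        ⟨(b, l₀), ⟨ht, fun i hi => ?_⟩, h⟩⟩
      simp only [Prod.mk.injEq] at h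
      have hir := hr.tokens_sub ⟨_, ht, hi⟩
      have h1 := hr.pos i hir
      have h2 := le_maxId hr.tokens_sub hir
      rcases hl' (i + n) (by rw [← h.2]; exact List.mem_map.2 ⟨i, hi, rfl⟩) with
        ⟨j, hj, hij⟩ | ⟨j, hj, hij⟩ | hij
      · obtain rfl : i = j := by omega
        exact hj
      · omega
      · omega
    have hB : shiftT n (shiftT (maxId r.chr r.tokens) v.tokens) =
        shiftT (n + maxId r.chr r.tokens) v.tokens := by
      simp only [shiftT, Set.image_image, List.map_map]
      congr 1
      funext t
      congr 2
      funext i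
      simp only [Function.comp]
      omega
    have hC : (a, l) ∈ shiftT n {t : Token N | v.remove = [] ∧ t = (v.name, ids S₁)} ↔
        S₂.map f = [] ∧ (a, l) = (v.name, ids (S₁.map f ++ S₂.map f)) := by
      have h1 : S₂ = [] ↔ v.remove = [] := by
        rw [← comparable_nil_iff hrm]; simp [chr]
      rw [← h1, List.map_eq_nil_iff]
      constructor
      · rintro ⟨_, ⟨h, rfl⟩, h'⟩
        refine ⟨h, ?_⟩
        rw [← h', h]
        simp only [List.map_nil, List.append_nil, hif]
      · rintro ⟨rfl, h⟩
        refine ⟨_, ⟨rfl, rfl⟩, ?_⟩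
        rw [h]
        simp only [List.map_nil, List.append_nil, hif]
    have hunion : ∀ A B : Set (Token N), shiftT n (A ∪ B) = shiftT n A ∪ shiftT n B :=
      fun A B => Set.image_union _ _ _
    simp only [σc, σb, σa, hunion, hB, Set.mem_union, hA, hC]
    simp only [Set.mem_ofPred_eq]
    rw [or_right_comm (b := List.map f S₂ = [] ∧ _)]
    simp only [or_assoc]

end Unfolding

/-! ### Simulation -/

section Simulation

variable {L : FirstOrder.Language.{u, v}} {Pr : Type w} {N : Type w'}

theorem perm_inv_image_image (κ : Equiv.Perm ℕ) (V : Set ℕ) : (κ⁻¹ : Equiv.Perm ℕ) '' (κ '' V) = V := by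
  rw [Set.image_image]; simp

theorem image_eq_of_fixed {κ : Equiv.Perm ℕ} {V : Set ℕ} (h : ∀ x ∈ V, κ x = x) : κ '' V = V := by
  rw [Set.image_congr h, Set.image_id']

theorem State.rename_inv_rename (κ : Equiv.Perm ℕ) (σ : State L Pr N) :
    (σ.rename κ).rename κ⁻¹ = σ := by
  rw [State.rename_rename, inv_mul_cancel, State.rename_one]

/-- A renamed rule can be renamed back, while variables not in it are moved off a finite set. -/
theorem exists_perm_pullback (r : Rule L Pr N) (ρ : Equiv.Perm ℕ) {A F : Set ℕ} (hA : A.Finite)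
    (hF : F.Finite) (hd : Disjoint (r.rename ρ).fv A) :
    ∃ κ : Equiv.Perm ℕ, (r.rename ρ).rename κ = r ∧ Disjoint F (κ '' A) := by
  obtain ⟨κ, h1, h2⟩ := exists_perm_avoiding r.finite_fv (hA.image (ρ⁻¹ : Equiv.Perm ℕ)) hF (by
    rw [← Set.disjoint_image_iff ρ.injective, ← Rule.fv_rename, Set.image_image]
    simpa using hd)
  refine ⟨κ * ρ⁻¹, ?_, ?_⟩
  · rw [Rule.rename_rename, inv_mul_cancel_right]
    conv_rhs => rw [← Rule.rename_one r]
    exact r.rename_congr h1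
  · rw [Set.disjoint_left]
    rintro _ hx ⟨y, hy, rfl⟩
    exact h2 _ ⟨y, hy, rfl⟩ hx

/-- The simulation relation up to a renaming of the variables not in `V`. -/
def SimUpTo (CT : L.Theory) (V : Set ℕ) (σ τ : State L Pr N) : Prop :=
  ∃ ρ : Equiv.Perm ℕ, (∀ x ∈ V, ρ x = x) ∧ Sim CT (σ.rename ρ) τ

theorem Sim.simUpTo {CT : L.Theory} {σ τ : State L Pr N} (h : Sim CT σ τ) (V : Set ℕ) :
    SimUpTo CT V σ τ :=
  ⟨1, fun _ _ => rfl, by rwa [State.rename_one]⟩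

theorem SimUpTo.trans_sim {CT : L.Theory} {V : Set ℕ} {σ τ υ : State L Pr N}
    (h : SimUpTo CT V σ τ) (h' : Sim CT τ υ) : SimUpTo CT V σ υ :=
  let ⟨ρ, h1, h2⟩ := h
  ⟨ρ, h1, h2.trans h'⟩

theorem Sim.trans_simUpTo {CT : L.Theory} {V : Set ℕ} {σ τ υ : State L Pr N}
    (h : Sim CT σ τ) (h' : SimUpTo CT V τ υ) : SimUpTo CT V σ υ :=
  let ⟨ρ, h1, h2⟩ := h'
  ⟨ρ, h1, (h.rename ρ).trans h2⟩

theorem SimUpTo.symm {CT : L.Theory} {V : Set ℕ} {σ τ : State L Pr N}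
    (h : SimUpTo CT V σ τ) (hτ : τ.WF) : SimUpTo CT V τ σ := by
  obtain ⟨ρ, h1, h2⟩ := h
  refine ⟨ρ⁻¹, fun x hx => by rw [Equiv.Perm.inv_eq_iff_eq, h1 x hx], ?_⟩
  have := (h2.symm hτ).rename ρ⁻¹
  rwa [State.rename_inv_rename] at this

/-- The rule instance is apart from `σ` but perhaps not from `τ`, whose store may mention other
variables. A permutation fixing `V` and the renamed variables of `σ` first moves the instance away
from `τ`. -/
theorem SimUpTo.applyWith {CT : L.Theory} {V : Set ℕ} (hV : V.Finite) {σ σ' τ : State L Pr N}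
    {r : Rule L Pr N} {ρ₁ : Equiv.Perm ℕ} (h : SimUpTo CT V σ τ) (hσ : σ.WF) (hτ : τ.WF)
    (hr : r.WF) (hbi : τ.bi = 0) (happ : ApplyWith CT (r.rename ρ₁) V σ σ') :
    ∃ (τ' : State L Pr N) (ρ₂ : Equiv.Perm ℕ), ApplyWith CT (r.rename ρ₂) V τ τ' ∧
      SimUpTo CT V σ' τ' := by
  obtain ⟨ρ, h1, h2⟩ := h
  have hfr : Disjoint (r.rename ρ₁).fv (V ∪ σ.fv) := by
    obtain ⟨_, _, _, _, hfr, _⟩ := happ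
    exact hfr
  obtain ⟨κ, h3, h4⟩ := exists_perm_avoiding ((hV.union σ.finite_fv).image ρ)
    ((r.rename ρ₁).finite_fv.image ρ) (hV.union τ.finite_fv)
    ((Set.disjoint_image_iff ρ.injective).2 hfr.symm)
  have hfix : ∀ x ∈ V, (κ * ρ) x = x := fun x hx => by
    rw [Equiv.Perm.mul_apply, h3 _ ⟨x, .inl hx, rfl⟩, h1 x hx]
  have happ' := happ.rename (κ * ρ)
  have hσκ : σ.rename (κ * ρ) = σ.rename ρ :=
    σ.rename_congr fun x hx => h3 _ ⟨x, .inr hx, rfl⟩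
  rw [image_eq_of_fixed hfix, hσκ] at happ'
  obtain ⟨τ', h5, h6⟩ := h2.applyWith (hσ.rename ρ) hτ ((hr.rename ρ₁).rename (κ * ρ)) hbi happ' (by
    rw [Set.disjoint_left, Rule.fv_rename]
    rintro _ ⟨y, hy, rfl⟩
    exact h4 _ ⟨y, hy, rfl⟩)
  rw [Rule.rename_rename] at h5
  exact ⟨τ', _, h5, _, hfix, h6⟩

/-- Variables of `r` or `v` may be missing from `r'`, so apartness from `r'` is not enough. The
instance is renamed back to `r'` while the configuration is moved off `r` and `v`; the computation
found there is then transported back. -/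
theorem exists_normalDerives_unfolding {CT : L.Theory} (hCT : ClarkEquality CT)
    {P : Set (Rule L Pr N)} (hP : ∀ r ∈ P, r.WF) {V : Set ℕ} (hV : V.Finite) {r r' : Rule L Pr N}
    (hr : r ∈ P) (hr' : r' ∈ Unf CT P r) {σ τ' : State L Pr N} (hσ : σ.WF) (hbi : σ.bi = 0)
    {ρ : Equiv.Perm ℕ} (happ : ApplyWith CT (r'.rename ρ) V σ τ') :
    ∃ τ, Relation.TransGen (NormalStep CT P V) σ τ ∧ τ.bi = 0 ∧ Sim CT τ' τ := by
  obtain ⟨v, hv, ρv, hvr, hunf⟩ := hr'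
  have hfr : Disjoint (r'.rename ρ).fv (V ∪ σ.fv) := by
    obtain ⟨_, _, _, _, hfr, _⟩ := happ
    exact hfr
  obtain ⟨κ, h1, h2⟩ := exists_perm_pullback r' ρ (hV.union σ.finite_fv)
    (r.finite_fv.union (v.rename ρv).finite_fv) hfr
  rw [Set.image_union, ← State.fv_rename] at h2
  have happ' := happ.rename κ
  rw [h1] at happ'
  obtain ⟨τ, h3, h4, h5⟩ := hunf.applyWith hCT ⟨r, hr, 1, (Rule.rename_one r).symm⟩
    ⟨v, hv, ρv, rfl⟩ (hP r hr) ((hP v hv).rename ρv) hvr (hσ.rename κ) (by simp [State.rename, hbi])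
    (Set.disjoint_of_subset_left Set.subset_union_left h2)
    (Set.disjoint_of_subset_left Set.subset_union_right h2) happ'
  refine ⟨τ.rename κ⁻¹, ?_, by simp [State.rename, h4], ?_⟩
  · have := Relation.TransGen.lift (p := NormalStep CT P V) (State.rename κ⁻¹) (fun a b h => by
      have := NormalStep.rename h κ⁻¹
      rwa [perm_inv_image_image] at this) _ _ h3
    simpa only [Function.onFun, State.rename_inv_rename] using this
  · have := h5.rename κ⁻¹
    rwa [State.rename_inv_rename] at this

/-- A rule can be applied where a rule with the same head and an equivalent guard can. -/
theorem ApplyWith.of_equivalent {CT : L.Theory} {V : Set ℕ} (hV : V.Finite) {r r' : Rule L Pr N}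
    (hname : r'.name = r.name) (hkeep : r'.keep = r.keep) (hremove : r'.remove = r.remove)
    (hguard : Equivalent CT r.guard r'.guard) {σ τ : State L Pr N} {ρ : Equiv.Perm ℕ}
    (happ : ApplyWith CT (r.rename ρ) V σ τ) :
    ∃ (τ' : State L Pr N) (ρ' : Equiv.Perm ℕ), ApplyWith CT (r'.rename ρ') V σ τ' := by
  have hfr : Disjoint (r.rename ρ).fv (V ∪ σ.fv) := by
    obtain ⟨_, _, _, _, hfr, _⟩ := happ
    exact hfr
  -- Guards are compared for the rules as they stand, so the instance is renamed back to `r`; the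
  -- configuration is also moved off `r'`, which may have further variables.
  obtain ⟨κ, h1, h2⟩ := exists_perm_pullback r ρ (hV.union σ.finite_fv) r'.finite_fv hfr
  rw [Set.image_union, ← State.fv_rename] at h2
  have happ' := happ.rename κ
  rw [h1] at happ'
  obtain ⟨H₁, H₂, K, hchr, _, hk, hrm, hent, htok, _⟩ := happ'
  have hhead : r'.head = r.head := by simp [Rule.head, hkeep, hremove]
  have key : ∃ τ', ApplyWith CT r' (κ '' V) (σ.rename κ) τ' := by
    refine ⟨_, H₁, H₂, K, hchr, h2, by rwa [hkeep], by rwa [hremove], fun M val hval => ?_,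
      by rwa [hname], rfl⟩
    obtain ⟨val', h3, h4⟩ := hent M val hval
    rw [hhead]
    rw [holds_add] at h4
    exact ⟨val', h3, holds_add.2 ⟨h4.1, (hguard M val').1 h4.2⟩⟩
  obtain ⟨τ', key⟩ := key
  have := key.rename κ⁻¹
  rw [perm_inv_image_image, State.rename_inv_rename] at this
  exact ⟨_, _, this⟩

/-- The simulating configuration is well-formed and has no unsolved constraints. -/
structure Simulates (CT : L.Theory) (V : Set ℕ) (σ τ : State L Pr N) : Prop where
  wf_left : σ.WF
  wf_right : τ.WF
  bi_eq : τ.bi = 0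
  simUpTo : SimUpTo CT V σ τ

theorem Simulates.realize {CT : L.Theory} {V : Set ℕ} {σ τ : State L Pr N}
    (h : Simulates CT V σ τ) : ∃ ρ : Equiv.Perm ℕ, (∀ x ∈ V, ρ x = x) ∧
      ∀ (M : Model CT) (val : ℕ → M),
        τ.store.Realize val ↔ σ.store.Realize (val ∘ ρ) ∧ Holds σ.bi (val ∘ ρ) := by
  obtain ⟨ρ, h1, _, _, h2, _⟩ := h.simUpTo
  refine ⟨ρ, h1, fun M val => ?_⟩
  have := h2 M val
  simpa only [h.bi_eq, holds_zero, and_true, State.rename, realize_rename, holds_rename] using this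

theorem Simulates.failed {CT : L.Theory} {V : Set ℕ} {σ τ : State L Pr N}
    (h : Simulates CT V σ τ) (hσ : σ.Failed CT) : τ.Failed CT := by
  obtain ⟨ρ, -, h⟩ := h.realize
  rw [State.Failed, inconsistent_iff] at *
  exact fun M val hval => hσ M _ ((h M val).1 hval).1

/-- Here `σ` need not have failed: the contradiction may involve constraints that are still
unsolved. -/
theorem Simulates.dead {CT : L.Theory} {V : Set ℕ} {σ τ : State L Pr N}
    (h : Simulates CT V σ τ) (hτ : τ.Failed CT) (M : Model CT) (val : ℕ → M) :
    ¬ (σ.store.Realize val ∧ Holds σ.bi val) := by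
  obtain ⟨ρ, -, h⟩ := h.realize
  rw [State.Failed, inconsistent_iff] at hτ
  intro hval
  refine hτ M (val ∘ ρ.symm) ((h M _).2 ?_)
  rwa [Function.comp_assoc, Equiv.symm_comp_self, Function.comp_id]

/-- A Solve' step is invisible to `Sim`, which compares solved and unsolved constraints jointly. -/
theorem Solve.sim {CT : L.Theory} {σ σ' : State L Pr N} (h : Solve CT σ σ') : Sim CT σ' σ := by
  obtain ⟨K, B, c, C, C', T, n, hC', h⟩ := h
  refine .of_id rfl (fun M val => ?_) fun _ _ _ => Iff.rfl
  have := iff_realize.1 h M val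
  rw [Formula.realize_inf] at this
  simp only [holds_cons, ← this]
  tauto

theorem Simulates.solve {CT : L.Theory} {V : Set ℕ} {σ σ' τ : State L Pr N}
    (h : Simulates CT V σ τ) (hs : Solve CT σ σ') : Simulates CT V σ' τ :=
  ⟨hs.wf h.wf_left, h.wf_right, h.bi_eq, hs.sim.trans_simUpTo h.simUpTo⟩

/-- Every configuration is simulated by the one in which its constraints are solved. -/
theorem State.WF.exists_simulates {CT : L.Theory} {σ : State L Pr N} (hσ : σ.WF)
    (P : Set (Rule L Pr N)) (V : Set ℕ) :
    ∃ τ, NormalDerives CT P V σ τ ∧ τ.WF ∧ τ.bi = 0 ∧ Sim CT σ τ := by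
  obtain ⟨S, B, C, T, n⟩ := σ
  obtain ⟨C', h1, h2, -, h3⟩ := exists_solve_all CT B S C T n hσ.bi_builtin hσ.store_builtin
  refine ⟨_, .of_solve h1 P V, ?_, rfl, .of_id rfl (fun M val => ?_) fun _ _ _ => Iff.rfl⟩
  · exact (NormalDerives.of_solve h1 (∅ : Set (Rule L Pr N)) ∅).derives.wf (by simp) hσ
  · simp [h3, holds_zero]

/-- That the simulating computation is nonempty is what transfers termination. -/
theorem Simulates.apply {CT : L.Theory} (hCT : ClarkEquality CT) {P Q : Set (Rule L Pr N)}
    (hP : ∀ r ∈ P, r.WF) (hQ : ∀ q ∈ Q, q.WF) (hPQ : ∀ q ∈ Q, q ∈ P ∨ ∃ r ∈ P, q ∈ Unf CT P r)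
    {V : Set ℕ} (hV : V.Finite) {σ σ' τ : State L Pr N} (h : Simulates CT V σ τ)
    (happ : Apply CT Q V σ σ') :
    ∃ τ', Relation.TransGen (NormalStep CT P V) τ τ' ∧ Simulates CT V σ' τ' := by
  have hσ' := happ.wf hQ h.wf_left
  obtain ⟨q, hq, ρ₁, happ⟩ := apply_iff.1 happ
  obtain ⟨τ₁, ρ₂, h1, h2⟩ := h.simUpTo.applyWith hV h.wf_left h.wf_right (hQ q hq) h.bi_eq happ
  rcases hPQ q hq with hqP | ⟨r, hr, hqr⟩
  · have h3 : NormalStep CT P V τ τ₁ := .inr ⟨.inr h.bi_eq, apply_iff.2 ⟨q, hqP, ρ₂, h1⟩⟩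
    obtain ⟨τ', h4, h5, h6, h7⟩ :=
      (h1.wf ((hQ q hq).rename ρ₂) h.wf_right).exists_simulates (CT := CT) P V
    exact ⟨τ', (Relation.TransGen.single h3).trans_left h4, hσ', h5, h6, h2.trans_sim h7⟩
  · obtain ⟨τ', h4, h5, h6⟩ := exists_normalDerives_unfolding hCT hP hV hr hqr h.wf_right h.bi_eq h1
    have h7 : Derives CT P V τ τ' :=
      NormalDerives.derives (Relation.TransGen.to_reflTransGen h4)
    exact ⟨τ', h4, hσ', h7.wf hP h.wf_right, h5, h2.trans_sim h6⟩

theorem Simulates.derives {CT : L.Theory} (hCT : ClarkEquality CT) {P Q : Set (Rule L Pr N)}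
    (hP : ∀ r ∈ P, r.WF) (hQ : ∀ q ∈ Q, q.WF) (hPQ : ∀ q ∈ Q, q ∈ P ∨ ∃ r ∈ P, q ∈ Unf CT P r)
    {V : Set ℕ} (hV : V.Finite) {σ σ' τ : State L Pr N} (h : Simulates CT V σ τ)
    (hd : Derives CT Q V σ σ') :
    ∃ τ', NormalDerives CT P V τ τ' ∧ Simulates CT V σ' τ' := by
  induction hd with
  | refl => exact ⟨τ, .refl, h⟩
  | tail _ hstep ih =>
    obtain ⟨τ₁, h1, h2⟩ := ih
    rcases hstep with hs | hs
    · exact ⟨τ₁, h1, h2.solve hs⟩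
    · obtain ⟨τ₂, h3, h4⟩ := h2.apply hCT hP hQ hPQ hV hs
      exact ⟨τ₂, h1.trans h3.to_reflTransGen, h4⟩

theorem bi_eq_zero_of_final {CT : L.Theory} {σ : State L Pr N} (hσ : σ.WF)
    (h : ∀ τ, ¬ Solve CT σ τ) : σ.bi = 0 := by
  obtain ⟨S, B, C, T, n⟩ := σ
  refine Multiset.eq_zero_of_forall_notMem fun c hc => ?_
  obtain ⟨B, rfl⟩ := Multiset.exists_cons_of_mem hc
  exact h _ (.intro S B c C (c ⊓ C) T n (.and (hσ.bi_builtin c hc) hσ.store_builtin)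
    (Theory.Iff.refl _))

/-- If a rule applied to `τ`, its counterpart in `Q` would too. Nothing is unsolved in the final
`σ`, so the reversed simulation would carry that application to `σ`. -/
theorem Simulates.final {CT : L.Theory} {P Q : Set (Rule L Pr N)} (hQ : ∀ q ∈ Q, q.WF)
    (hPQ : ∀ r ∈ P, ∃ q ∈ Q, q.name = r.name ∧ q.keep = r.keep ∧ q.remove = r.remove ∧
      Equivalent CT r.guard q.guard)
    {V : Set ℕ} (hV : V.Finite) {σ τ : State L Pr N} (h : Simulates CT V σ τ)
    (hσ : ∀ σ', ¬ Step CT Q V σ σ') (τ' : State L Pr N) : ¬ Step CT P V τ τ' := by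
  rintro (hs | hs)
  · obtain ⟨K, B, c, C, C', T, n, hC', hs⟩ := hs
    simpa using h.bi_eq
  · obtain ⟨r, hr, ρ, happ⟩ := apply_iff.1 hs
    obtain ⟨q, hq, h1, h2, h3, h4⟩ := hPQ r hr
    obtain ⟨τ₁, ρ₁, happ⟩ := happ.of_equivalent hV h1 h2 h3 h4
    obtain ⟨σ', ρ₂, h5, _⟩ := (h.simUpTo.symm h.wf_right).applyWith hV h.wf_right h.wf_left
      (hQ q hq) (bi_eq_zero_of_final h.wf_left fun τ hτ => hσ τ (.inl hτ)) happ
    exact hσ σ' (.inr (apply_iff.2 ⟨q, hq, ρ₂, h5⟩))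

/-! ### Termination -/

/-- The steps of normal computations in which failed configurations are final. -/
def Succ (CT : L.Theory) (P : Set (Rule L Pr N)) (V : Set ℕ) (τ σ : State L Pr N) : Prop :=
  ¬ σ.Failed CT ∧ NormalStep CT P V σ τ

theorem NormalTerminating.acc {CT : L.Theory} {P : Set (Rule L Pr N)}
    (h : NormalTerminating CT P) {G : Goal L Pr} (hG : G.WF) :
    Acc (Succ CT P G.fv) (G.init N) := by
  by_contra hacc
  obtain ⟨f, h0, hf⟩ := not_acc_iff_exists_descending_chain.1 hacc
  exact h G hG ⟨f, h0, hf⟩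

/-- A normal computation must solve all constraints before a rule can apply, unless it has failed
already. Contradictory constraints then make the store inconsistent, so the number of unsolved
constraints bounds the steps left. -/
theorem acc_of_dead {CT : L.Theory} {Q : Set (Rule L Pr N)} {V : Set ℕ} :
    ∀ (n : ℕ) (σ : State L Pr N), Multiset.card σ.bi = n →
      (∀ (M : Model CT) (val : ℕ → M), ¬ (σ.store.Realize val ∧ Holds σ.bi val)) →
      Acc (Succ CT Q V) σ := by
  intro n
  induction n with
  | zero =>
    intro σ hn hdead
    refine .intro σ fun σ' h => absurd ?_ h.1
    rw [State.Failed, inconsistent_iff]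
    intro M val hval
    refine hdead M val ⟨hval, ?_⟩
    rw [Multiset.card_eq_zero.1 hn]
    exact holds_zero
  | succ n ih =>
    intro σ hn hdead
    refine .intro σ fun σ' ⟨hf, h⟩ => ?_
    rcases h with h | ⟨h | h, -⟩
    · obtain ⟨-, -, h2, -⟩ := h.sim
      refine ih σ' ?_ fun M val hval => hdead M val ((h2 M val).2 hval)
      obtain ⟨K, B, c, C, C', T, n, hC', h⟩ := h
      simpa using hn
    · exact absurd h hf
    · simp [h] at hn

/-- Failure persists, so a computation with a non-failed end has no failed configuration on the way
and all its steps count for termination. -/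
theorem failed_or_transGen_succ {CT : L.Theory} {P : Set (Rule L Pr N)} {V : Set ℕ}
    {σ τ : State L Pr N} (h : Relation.TransGen (NormalStep CT P V) σ τ) :
    τ.Failed CT ∨ Relation.TransGen (Succ CT P V) τ σ := by
  induction h with
  | single h =>
    by_cases hf : σ.Failed CT
    · exact .inl (h.step.failed hf)
    · exact .inr (.single ⟨hf, h⟩)
  | @tail b c _ h ih =>
    by_cases hf : b.Failed CT
    · exact .inl (h.step.failed hf)
    · exact .inr (.head ⟨hf, h⟩ (ih.resolve_left hf))

/-- Lexicographic descent: rule applications descend in the computations of `P`, Solve' steps in the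
number of unsolved constraints. Once the simulating configuration fails, `acc_of_dead` takes over.
-/
theorem Simulates.acc {CT : L.Theory} (hCT : ClarkEquality CT) {P Q : Set (Rule L Pr N)}
    (hP : ∀ r ∈ P, r.WF) (hQ : ∀ q ∈ Q, q.WF) (hPQ : ∀ q ∈ Q, q ∈ P ∨ ∃ r ∈ P, q ∈ Unf CT P r)
    {V : Set ℕ} (hV : V.Finite) {τ : State L Pr N}
    (hacc : Acc (Relation.TransGen (Succ CT P V)) τ) :
    ∀ σ, Simulates CT V σ τ → Acc (Succ CT Q V) σ := by
  induction hacc with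
  | intro τ _ ih =>
    suffices ∀ (n : ℕ) (σ : State L Pr N), Multiset.card σ.bi = n → Simulates CT V σ τ →
        Acc (Succ CT Q V) σ from fun σ hσ => this _ σ rfl hσ
    intro n
    induction n with
    | zero =>
      intro σ hn h
      refine .intro σ fun σ' ⟨hf, hs⟩ => ?_
      rcases hs with hs | ⟨-, hs⟩
      · obtain ⟨K, B, c, C, C', T, n, hC', hs⟩ := hs
        simp at hn
      · obtain ⟨τ', h1, h2⟩ := h.apply hCT hP hQ hPQ hV hs
        rcases failed_or_transGen_succ h1 with h3 | h3
        · exact acc_of_dead _ _ rfl (h2.dead h3)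
        · exact ih τ' h3 σ' h2
    | succ n ihn =>
      intro σ hn h
      refine .intro σ fun σ' ⟨hf, hs⟩ => ?_
      rcases hs with hs | ⟨hs | hs, -⟩
      · refine ihn σ' ?_ (h.solve hs)
        obtain ⟨K, B, c, C, C', T, n, hC', hs⟩ := hs
        simpa using hn
      · exact absurd hs hf
      · simp [hs] at hn

theorem exists_normalDerives_final {CT : L.Theory} {Q : Set (Rule L Pr N)} {V : Set ℕ}
    {σ : State L Pr N} (h : Acc (Succ CT Q V) σ) :
    ∃ τ, NormalDerives CT Q V σ τ ∧ (τ.Failed CT ∨ ∀ τ', ¬ NormalStep CT Q V τ τ') := by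
  induction h with
  | intro σ _ ih =>
    by_cases hf : σ.Failed CT
    · exact ⟨σ, .refl, .inl hf⟩
    · by_cases hs : ∃ τ, NormalStep CT Q V σ τ
      · obtain ⟨τ, hs⟩ := hs
        obtain ⟨τ', h1, h2⟩ := ih τ ⟨hf, hs⟩
        exact ⟨τ', .head hs h1, h2⟩
      · exact ⟨σ, .refl, .inr (not_exists.1 hs)⟩

/-! ### Answers -/

theorem SameAnswer.symm {CT : L.Theory} {V : Set ℕ} {a b : Answer L Pr}
    (h : SameAnswer CT V a b) : SameAnswer CT V b a := by
  rcases h with h | ⟨ρ, h1, h2, h3⟩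
  · exact .inl h.symm
  · refine .inr ⟨ρ⁻¹, fun x hx => by rw [Equiv.Perm.inv_eq_iff_eq, h1 x hx], ?_, ?_⟩
    · rw [← h2, Multiset.map_map]
      conv_rhs => rw [← Multiset.map_id a.1]
      refine Multiset.map_congr rfl fun x _ => ?_
      rw [Function.comp_apply, Atom.subst_subst, inv_mul_cancel, Atom.subst_one]; rfl
    · have := iff_rename ρ⁻¹ h3
      rw [substF_substF, inv_mul_cancel, substF_one] at this
      exact this.symm

theorem inconsistent_congr {CT : L.Theory} {c d : L.Formula ℕ} (h : CT.Iff c d) :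
    Inconsistent CT c ↔ Inconsistent CT d :=
  ⟨fun hc => h.symm.trans hc, fun hd => h.trans hd⟩

theorem SameAnswer.trans {CT : L.Theory} {V : Set ℕ} {a b c : Answer L Pr}
    (h : SameAnswer CT V a b) (h' : SameAnswer CT V b c) : SameAnswer CT V a c := by
  rcases h with h | ⟨ρ, h1, h2, h3⟩ <;> rcases h' with h' | ⟨ρ', h1', h2', h3'⟩
  · exact .inl ⟨h.1, h'.2⟩
  · exact .inl ⟨h.1, (inconsistent_congr h3').1 ((inconsistent_rename ρ').2 h.2)⟩
  · exact .inl ⟨(inconsistent_rename ρ).1 ((inconsistent_congr h3).2 h'.1), h'.2⟩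
  · refine .inr ⟨ρ' * ρ, fun x hx => by rw [Equiv.Perm.mul_apply, h1 x hx, h1' x hx], ?_, ?_⟩
    · rw [← h2', ← h2, Multiset.map_map]
      exact Multiset.map_congr rfl fun x _ => (Atom.subst_subst ρ' ρ x).symm
    · rw [← substF_substF]
      exact (iff_rename ρ' h3).trans h3'

/-- The answer read off a configuration. -/
def State.answer (σ : State L Pr N) : Answer L Pr := (σ.chr.map Prod.fst, σ.store)

/-- The configurations that yield an answer. -/
def State.Final (CT : L.Theory) (P : Set (Rule L Pr N)) (V : Set ℕ) (σ : State L Pr N) : Prop :=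
  σ.Failed CT ∨ ∀ τ, ¬ Step CT P V σ τ

/-- The answer read off a failed configuration is identified with `false`, so the two parts of the
answer set merge. -/
theorem mem_QA'_iff {CT : L.Theory} {P : Set (Rule L Pr N)} {G : Goal L Pr} {a : Answer L Pr} :
    a ∈ QA' CT P G ↔ ∃ σ, Derives CT P G.fv (G.init N) σ ∧ σ.Final CT P G.fv ∧
      SameAnswer CT G.fv a σ.answer := by
  have hbot : ∀ σ : State L Pr N, σ.Failed CT → SameAnswer CT G.fv σ.answer (0, ⊥) := fun σ hσ =>
    .inl ⟨hσ, Theory.Iff.refl _⟩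
  constructor
  · rintro (⟨σ, h1, h2, h3⟩ | ⟨σ, h1, h2, h3⟩)
    · exact ⟨σ, h1, .inr h2, h3⟩
    · exact ⟨σ, h1, .inl h2, h3.trans (hbot σ h2).symm⟩
  · rintro ⟨σ, h1, h2 | h2, h3⟩
    · exact .inr ⟨σ, h1, h2, h3.trans (hbot σ h2)⟩
    · exact .inl ⟨σ, h1, h2, h3⟩

theorem Simulates.sameAnswer {CT : L.Theory} {V : Set ℕ} {σ τ : State L Pr N}
    (h : Simulates CT V σ τ) (hbi : σ.bi = 0) : SameAnswer CT V σ.answer τ.answer := by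
  obtain ⟨ρ, h1, π, h2, h3, _⟩ := h.simUpTo
  refine .inr ⟨ρ, h1, ?_, ?_⟩
  · simp [State.answer, h2, State.rename, renameI, Function.comp_def]
  · rw [iff_realize]
    intro M val
    have := h3 M val
    simp only [h.bi_eq, State.rename, hbi, Multiset.map_zero, holds_zero, and_true] at this
    exact this.symm

theorem StateEquiv.sameAnswer {CT : L.Theory} {V : Set ℕ} {σ τ : State L Pr N}
    (h : StateEquiv CT V σ τ) : SameAnswer CT V σ.answer τ.answer := by
  rcases h with h | ⟨ρ, π, h1, h2, -, h3, -⟩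
  · exact .inl h
  · refine .inr ⟨ρ, h1, ?_, h3⟩
    simp [State.answer, ← h2]

theorem Goal.init_wf {G : Goal L Pr} (hG : G.WF) : (G.init N).WF := by
  have hids : ids (G.atoms.zipIdx 1) = List.range' 1 G.atoms.length := by
    simp [ids]
  have hmem : ∀ i ∈ idSet (G.init N).chr, 0 < i ∧ i ≤ G.atoms.length := fun i hi => by
    have : i ∈ ids (G.atoms.zipIdx 1) := by
      have h := idSet_coe (G.atoms.zipIdx 1)
      exact h.subset hi
    rw [hids, List.mem_range'_1] at this
    omega
  refine ⟨hG, .tru, ?_, fun i hi => (hmem i hi).1, fun i hi => (hmem i hi).2, ?_⟩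
  · show (Multiset.ofList _).Nodup
    rw [Multiset.coe_nodup]
    show (ids (G.atoms.zipIdx 1)).Nodup
    rw [hids]
    exact List.nodup_range'
  · rintro i ⟨t, ht, -⟩
    exact ht.elim

theorem Goal.init_fv (G : Goal L Pr) : (G.init N).fv = G.fv := by
  have h1 : fvI (↑(G.atoms.zipIdx 1) : Multiset (IdAtom L Pr)) = fvA G.atoms := by
    rw [fvI_coe, chr, List.zipIdx_map_fst]
  have h2 : fvF {(⊤ : L.Formula ℕ)} = ∅ := by
    ext x
    simp [fvF]
  simp only [State.fv, Goal.init, h1, h2, Set.union_empty, Goal.fv]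

/-- The simulating program reaches every answer by a normal derivation. -/
theorem exists_normalDerives_sameAnswer {CT : L.Theory} (hCT : ClarkEquality CT)
    {P Q : Set (Rule L Pr N)} (hP : ∀ r ∈ P, r.WF) (hQ : ∀ q ∈ Q, q.WF)
    (hQP : ∀ q ∈ Q, q ∈ P ∨ ∃ r ∈ P, q ∈ Unf CT P r)
    (hPQ : ∀ r ∈ P, ∃ q ∈ Q, q.name = r.name ∧ q.keep = r.keep ∧ q.remove = r.remove ∧
      Equivalent CT r.guard q.guard)
    {G : Goal L Pr} (hG : G.WF) {σ : State L Pr N} (hd : Derives CT Q G.fv (G.init N) σ)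
    (hσ : σ.Final CT Q G.fv) :
    ∃ τ, NormalDerives CT P G.fv (G.init N) τ ∧ τ.Final CT P G.fv ∧
      SameAnswer CT G.fv σ.answer τ.answer := by
  obtain ⟨τ₀, h1, h2, h3, h4⟩ := (Goal.init_wf (N := N) hG).exists_simulates (CT := CT) P G.fv
  obtain ⟨τ, h5, h6⟩ := Simulates.derives hCT hP hQ hQP G.finite_fv
    ⟨Goal.init_wf hG, h2, h3, h4.simUpTo G.fv⟩ hd
  rcases hσ with hσ | hσ
  · exact ⟨τ, h1.trans h5, .inl (h6.failed hσ), .inl ⟨hσ, h6.failed hσ⟩⟩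
  · exact ⟨τ, h1.trans h5, .inr (h6.final hQ hPQ G.finite_fv hσ),
      h6.sameAnswer (bi_eq_zero_of_final h6.wf_left fun τ hτ => hσ τ (.inl hτ))⟩

theorem exists_derives_final {CT : L.Theory} (hCT : ClarkEquality CT)
    {P Q : Set (Rule L Pr N)} (hP : ∀ r ∈ P, r.WF) (hQ : ∀ q ∈ Q, q.WF)
    (hQP : ∀ q ∈ Q, q ∈ P ∨ ∃ r ∈ P, q ∈ Unf CT P r) (hterm : NormalTerminating CT P)
    {G : Goal L Pr} (hG : G.WF) :
    ∃ σ, Derives CT Q G.fv (G.init N) σ ∧ σ.Final CT Q G.fv := by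
  obtain ⟨τ₀, h1, h2, h3, h4⟩ := (Goal.init_wf (N := N) hG).exists_simulates (CT := CT) P G.fv
  have hs : Simulates CT G.fv (G.init N) τ₀ := ⟨Goal.init_wf hG, h2, h3, h4.simUpTo G.fv⟩
  have hacc : Acc (Succ CT Q G.fv) (G.init N) := by
    have hP' := (hterm.acc hG).transGen
    -- Solving the goal in `P` takes no step, ends in failure, or descends along the terminating
    -- relation.
    rcases Relation.reflTransGen_iff_eq_or_transGen.1 h1 with rfl | h5
    · exact hs.acc hCT hP hQ hQP G.finite_fv hP'
    · rcases failed_or_transGen_succ h5 with h6 | h6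
      · exact acc_of_dead _ _ rfl (hs.dead h6)
      · exact Simulates.acc hCT hP hQ hQP G.finite_fv (hP'.inv h6) _ hs
  obtain ⟨σ, h5, h6⟩ := exists_normalDerives_final hacc
  refine ⟨σ, h5.derives, ?_⟩
  by_cases hf : σ.Failed CT
  · exact .inl hf
  · have h7 := h6.resolve_left hf
    -- With no Solve' step available nothing is unsolved, so the normality restriction on Apply' is
    -- void.
    refine .inr fun τ hτ => h7 τ (hτ.imp id fun h => ⟨.inr ?_, h⟩)
    exact bi_eq_zero_of_final (h5.derives.wf hQ (Goal.init_wf hG)) fun τ hτ => h7 τ (.inl hτ)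

/-- Confluence joins configurations only after further steps. These cannot change a final answer:
failure persists, and other final configurations have no step. -/
theorem State.Final.sameAnswer_of_derives {CT : L.Theory} {P : Set (Rule L Pr N)} {V : Set ℕ}
    {σ τ : State L Pr N} (hσ : σ.Final CT P V) (h : Derives CT P V σ τ) :
    SameAnswer CT V σ.answer τ.answer := by
  rcases hσ with hσ | hσ
  · exact .inl ⟨hσ, h.failed hσ⟩
  · rcases Relation.ReflTransGen.cases_head h with rfl | ⟨υ, hs, -⟩
    · exact .inr ⟨1, fun _ _ => rfl, by
        conv_rhs => rw [← Multiset.map_id σ.answer.1]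
        exact Multiset.map_congr rfl fun a _ => Atom.subst_one a, by
        rw [substF_one]⟩
    · exact absurd hs (hσ υ)

/-- A normal confluent program has at most one answer from normal derivations. -/
theorem NormalConfluent.sameAnswer {CT : L.Theory} {P : Set (Rule L Pr N)}
    (hconf : NormalConfluent CT P) {G : Goal L Pr} (hG : G.WF) {σ τ : State L Pr N}
    (h1 : NormalDerives CT P G.fv (G.init N) σ) (h2 : NormalDerives CT P G.fv (G.init N) τ)
    (hσ : σ.Final CT P G.fv) (hτ : τ.Final CT P G.fv) :
    SameAnswer CT G.fv σ.answer τ.answer := by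
  have h := hconf (G.init N) σ τ (Goal.init_wf hG)
  rw [Goal.init_fv] at h
  obtain ⟨σ', τ', h3, h4, h5⟩ := h h1 h2
  exact ((hσ.sameAnswer_of_derives h3).trans h5.sameAnswer).trans
    (hτ.sameAnswer_of_derives h4).symm

end Simulation

end CHR

/-! ### Equality of the two answer sets -/

theorem mainTheorem5 {L : FirstOrder.Language.{u, v}} {Pr : Type w} {N : Type w'}
    (CT : L.Theory) (hCT : CHR.ClarkEquality CT)
    (P P' : Set (CHR.Rule L Pr N)) (hP : CHR.IsProgram P)
    (hterm : CHR.NormalTerminating CT P) (hconf : CHR.NormalConfluent CT P)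
    (r : CHR.Rule L Pr N) (hr : CHR.WeaklySafelyReplaceable CT P r)
    (hP' : P' = (P \ {r}) ∪ CHR.Unf CT P r)
    (G : CHR.Goal L Pr) (hG : G.WF) :
    CHR.QA' CT P G = CHR.QA' CT P' G := by
  obtain ⟨hrP, r', hr', hguard⟩ := hr
  have hPwf := hP.2
  have hP'wf : ∀ q ∈ P', q.WF := by
    rw [hP']
    rintro q (⟨hq, -⟩ | ⟨v, hv, ρ, -, hq⟩)
    exacts [hPwf q hq, hq.wf (hPwf r hrP) ((hPwf v hv).rename ρ)]
  have hP'P : ∀ q ∈ P', q ∈ P ∨ ∃ r ∈ P, q ∈ CHR.Unf CT P r := by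
    rw [hP']
    rintro q (⟨hq, -⟩ | hq)
    exacts [.inl hq, .inr ⟨r, hrP, hq⟩]
  have hPP' : ∀ s ∈ P, ∃ q ∈ P', q.name = s.name ∧ q.keep = s.keep ∧ q.remove = s.remove ∧
      CHR.Equivalent CT s.guard q.guard := by
    intro s hs
    by_cases hsr : s = r
    · subst hsr
      refine ⟨r', by rw [hP']; exact .inr hr', ?_⟩
      obtain ⟨v, hv, ρ, -, hunf⟩ := hr'
      obtain ⟨K, S₁, S₂, θ, D'', -, -, -, -, -, -, -, -, rfl⟩ := hunf.exists_eq
      exact ⟨rfl, rfl, rfl, hguard⟩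
    · exact ⟨s, by rw [hP']; exact .inl ⟨hs, hsr⟩, rfl, rfl, rfl, fun _ _ => Iff.rfl⟩
  ext a
  rw [CHR.mem_QA'_iff, CHR.mem_QA'_iff]
  constructor
  · rintro ⟨σ, h1, h2, h3⟩
    -- Simulating `P` by itself turns an arbitrary derivation into a normal one.
    obtain ⟨τ₁, h4, h5, h6⟩ := CHR.exists_normalDerives_sameAnswer hCT hPwf hPwf
      (fun q hq => .inl hq) (fun s hs => ⟨s, hs, rfl, rfl, rfl, fun _ _ => Iff.rfl⟩) hG h1 h2
    -- Any answer of `P'` will do: its simulation in `P` is normal, so confluence identifies it with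
    -- the given answer.
    obtain ⟨σ', h7, h8⟩ := CHR.exists_derives_final hCT hPwf hP'wf hP'P hterm hG
    obtain ⟨τ₂, h9, h10, h11⟩ := CHR.exists_normalDerives_sameAnswer hCT hPwf hP'wf hP'P hPP' hG
      h7 h8
    exact ⟨σ', h7, h8,
      ((h3.trans h6).trans (hconf.sameAnswer hG h4 h9 h5 h10)).trans h11.symm⟩
  · rintro ⟨σ, h1, h2, h3⟩
    obtain ⟨τ, h4, h5, h6⟩ := CHR.exists_normalDerives_sameAnswer hCT hPwf hP'wf hP'P hPP' hG h1 h2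
    exact ⟨τ, h4.derives, h5, h3.trans h6⟩
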